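/- All vector spaces are over $\mathbb{Q}$. **$\iota$-complexes.** An $\iota$-complex $(\mathcal K,\mathcal K_\iota,\iota)$ consists of two cochain complexes $(\mathcal K^i,d)$, $(\mathcal K^i_\iota,d_\iota)$ and linear maps $\iota^i:\mathcal K^i\to\mathcal K^{i-1}_\iota$ with $\iota\circ d=-d_\iota\circ\iota$. A map of $\iota$-complexes is a pair $(f^i,f^i_\iota)$ of sequences of linear maps of degree $0$ commuting with the differentials and with $\iota$. An $\iota$-chain homotopy between $f,g:\mathcal K\to\mathcal L$ is a pair of sequences $s^i:\mathcal K^i\to\mathcal L^{i-1}$, $s^i_\iota:\mathcal K^i_\iota\to\mathcal L^{i-1}_\iota$ with $d s+s d=f-g$, $d_\iota s_\iota+s_\iota d_\iota=f_\iota-g_\iota$ and $s_\iota\circ\iota+\iota\circ s=0$. **Diagrams.** Consider finite graphs (loops and parallel edges allowed, the empty graph included) with vertices of degree $3$, each with a cyclic order of its incident half-edges, and of degree $1$. The degree $1$ vertices ("legs") have grade $1$ or $2$ and are arranged along orienting lines, so that all legs are totally ordered. * $\widetilde{\mathcal W}^i$ is spanned by the isomorphism classes of such diagrams of total leg-grade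 $i$ with all legs on a single (non-commutative) line, modulo the antisymmetry relation AS (reversing the cyclic order at a trivalent vertex changes the sign; in particular a diagram with a loop is zero) and the Jacobi relation IHX. * $\mathcal T^i$ is defined in the same way with two lines, a non-commutative one and a commutative one, each leg lying on one of them. Besides AS and IHX one imposes: two adjacent legs of grades $x,y$ may be exchanged at the cost of the sign $(-1)^{xy}$, unless both lie on the non-commutative line. * $\mathcal T^i_{\mathrm{dR}}$ is defined like $\mathcal T^i$, with a third line that carries hollow discs $\circ$ of grade $0$ and filled discs $\bullet$ of grade $1$. Discs are part of the total order and of the total grade, and they may be exchanged with adjacent legs and discs with the sign $(-1)^{xy}$. * $\widetilde{\mathcal W}^i_\iota$, $\mathcal T^i_\iota$, $\mathcal T^i_{\mathrm{dR},\iota}$ are defined in the same way from diagrams that have in addition exactly one special degree $1$ vertex, labelled $\iota$, which lies on no line and has no grade. **Operators.** For a rule $x\mapsto D(x)$ on legs and discs, the associated operator of odd degree sends a diagram with legs and discs $x_1<\dots<x_n$ to $\sum_k(-1)^{|x_1|+\dots+|x_{k-1}|}$ times the diagram in which $x_k$ is replaced by $D(x_k)$. On all the spaces above, the differential $d$ (degree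 $+1$) is given by: grade $1$ leg $\mapsto$ grade $2$ leg on the same line, grade $2$ leg $\mapsto0$, $\circ\mapsto\bullet$, $\bullet\mapsto0$. The map $\iota$ (degree $-1$, from diagrams without special vertex to diagrams with one) is given by: grade $1$ leg $\mapsto$ this leg is taken off its line and becomes the special vertex; grade $2$ leg $\mapsto$ the leg's edge $e$ now ends at a new trivalent vertex with cyclic order ($e$, edge to the special vertex $\iota$, edge ending in a grade $1$ leg in the old position on the same line); $\circ,\bullet\mapsto0$. **Maps.** $i_n,i_c:\widetilde{\mathcal W}\to\mathcal T$ put all legs on the non-commutative, respectively the commutative line. $\theta:\widetilde{\mathcal W}\to\mathcal T_{\mathrm{dR}}$ replaces each leg as follows, where $n_g$ and $c_g$ denote the grade $g$ leg placed on the non-commutative, respectively commutative line, and products denote consecutive positions: $$\text{grade }1\mapsto n_1\circ+c_1-c_1\circ,\qquad \text{grade }2\mapsto n_2\circ-n_1\bullet+c_2-c_2\circ+c_1\bullet .$$ $\int:\mathcal T^i_{\mathrm{dR}}\to\mathcal T^{i-1}$ is zero on a diagram unless it has precisely one filled disc; in that case move this disc, with the appropriate sign, to the left of all legs and discs, remove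 all discs, and multiply by $\frac1{m+1}$, where $m$ is the number of hollow discs. The same rules define these maps on the spaces with a special vertex. **Theorem.** With these definitions $(\widetilde{\mathcal W},\widetilde{\mathcal W}_\iota,\iota)$ and $(\mathcal T,\mathcal T_\iota,\iota)$ are $\iota$-complexes, $i_n$ and $i_c$ are maps of $\iota$-complexes, and $$s_{\mathcal T}=\textstyle\int\circ\,\theta:\widetilde{\mathcal W}\to\mathcal T$$ is an $\iota$-chain homotopy between $i_n$ and $i_c$. That is, $d s_{\mathcal T}+s_{\mathcal T}d=i_n-i_c$ on $\widetilde{\mathcal W}^i$ and on $\widetilde{\mathcal W}^i_\iota$ for all $i$, and $s_{\mathcal T}\circ\iota+\iota\circ s_{\mathcal T}=0$. -/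

import Mathlib

noncomputable section

namespace WeilDiag

/-- The two orienting lines that carry legs: the non-commutative line `nc` and the commutative
line `com`. -/
inductive Line
  | nc
  | com
  deriving DecidableEq

/-- One item met by a vertical line sweeping from left to right along the orienting lines:
a leg of grade 1 or of grade 2 (a fat dot) on the line `l`, ending the edge named `e`, or a hollow
or filled disc on the third line. -/
inductive Entry
  | leg1 (l : Line) (e : ℕ)
  | leg2 (l : Line) (e : ℕ)
  | hollow
  | filled
  deriving DecidableEq

namespace Entry

/-- The grade. -/
def deg : Entry → ℕ
  | leg1 _ _ => 1
  | leg2 _ _ => 2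
  | hollow => 0
  | filled => 1

/-- The edge ends carried by an entry. -/
def names : Entry → Multiset ℕ
  | leg1 _ e => {e}
  | leg2 _ e => {e}
  | hollow => 0
  | filled => 0

/-- The entry is a leg on the non-commutative line. -/
def OnNC : Entry → Prop
  | leg1 l _ => l = Line.nc
  | leg2 l _ => l = Line.nc
  | hollow => False
  | filled => False

def isLeg : Entry → Bool
  | leg1 _ _ => true
  | leg2 _ _ => true
  | hollow => false
  | filled => false

/-- Rename the edges. -/
def relabel (f : ℕ → ℕ) : Entry → Entry
  | leg1 l e => leg1 l (f e)
  | leg2 l e => leg2 l (f e)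
  | hollow => hollow
  | filled => filled

/-- The sign `(-1)^deg` for an operator of odd grade passing the entry. -/
def sgn (x : Entry) : ℚ := (-1) ^ x.deg

end Entry

/-- A uni-trivalent graph with legs on orienting lines, written down by naming its edges with
natural numbers. A trivalent vertex is the triple `(a, b, c)` of the names of its three incident
edges, listed in the counter-clockwise cyclic order given by its orientation; the legs (and discs)
are listed in their order along the orienting lines; `ends` are the edges that end in a special
univalent vertex labelled by the symbol `ι`, which lies on no line. Such data describe a graph when
every name that occurs does so exactly twice (the two ends of the edge); see `IsDiagram`. -/
@[ext]
structure PreDiagram where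
  verts : Multiset (ℕ × ℕ × ℕ)
  word : List Entry
  ends : Multiset ℕ

namespace PreDiagram

/-- Juxtaposition: the entries of `B` are put to the right of those of `A`, and no edge is renamed,
so that equal names get joined up. -/
instance : Monoid PreDiagram where
  mul A B := ⟨A.verts + B.verts, A.word ++ B.word, A.ends + B.ends⟩
  one := ⟨0, [], 0⟩
  mul_assoc A B C := PreDiagram.ext (add_assoc _ _ _) (List.append_assoc _ _ _) (add_assoc _ _ _)
  one_mul A := PreDiagram.ext (zero_add _) (List.nil_append _) (zero_add _)
  mul_one A := PreDiagram.ext (add_zero _) (List.append_nil _) (add_zero _)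

theorem mul_def (A B : PreDiagram) :
    A * B = ⟨A.verts + B.verts, A.word ++ B.word, A.ends + B.ends⟩ := rfl

theorem one_def : (1 : PreDiagram) = ⟨0, [], 0⟩ := rfl

/-- All the edge ends of the graph, by the name of the edge. -/
def names (D : PreDiagram) : Multiset ℕ :=
  (D.verts.map fun v => ({v.1, v.2.1, v.2.2} : Multiset ℕ)).sum
    + (D.word.map Entry.names).sum + D.ends

/-- The total grade of the legs and discs. -/
def deg (D : PreDiagram) : ℕ := (D.word.map Entry.deg).sum

/-- Rename the edges. -/
def relabel (f : ℕ → ℕ) (D : PreDiagram) : PreDiagram :=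
  ⟨D.verts.map fun v => (f v.1, f v.2.1, f v.2.2), D.word.map (Entry.relabel f), D.ends.map f⟩

end PreDiagram

/-- The three types of diagrams: `W`, non-commutative Weil diagrams, where all legs are on the
non-commutative line; `T`, where the legs are on the non-commutative and the commutative line; and
`TdR`, where there is also a third line, carrying discs. -/
inductive Kind
  | W
  | T
  | TdR

/-- The entries that may occur in a diagram of a given type. -/
def Kind.Allows : Kind → Entry → Prop
  | W, x => x.OnNC
  | T, x => x.isLeg = true
  | TdR, _ => True

/-- `D` is a diagram of type `κ` and of total grade `i` with exactly `k` special `ι`-labelled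
vertices. -/
structure IsDiagram (κ : Kind) (k : ℕ) (i : ℤ) (D : PreDiagram) : Prop where
  allows : ∀ x ∈ D.word, κ.Allows x
  card_ends : D.ends.card = k
  deg_eq : (D.deg : ℤ) = i
  count_names : ∀ e ∈ D.names, D.names.count e = 2

/-- Formal finite rational linear combinations, with the product given by juxtaposition. -/
abbrev Comb : Type := MonoidAlgebra ℚ PreDiagram

/-- A single (pre-)diagram as a formal linear combination. -/
def gen : PreDiagram →* Comb := MonoidAlgebra.of ℚ PreDiagram

/-- Linear extension of a function given on generators. -/
def linExt {N : Type*} [AddCommGroup N] [Module ℚ N] (F : PreDiagram → N) : Comb →ₗ[ℚ] N :=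
  (MonoidAlgebra.basis PreDiagram ℚ).constr ℚ F

theorem linExt_gen {N : Type*} [AddCommGroup N] [Module ℚ N] (F : PreDiagram → N)
    (D : PreDiagram) : linExt F (gen D) = F D := by
  have := (MonoidAlgebra.basis PreDiagram ℚ).constr_basis ℚ F D
  simpa [linExt, gen, MonoidAlgebra.basis] using this

theorem Comb.induction {p : Comb → Prop} (x : Comb) (_h0 : p 0) (hg : ∀ D, p (gen D))
    (ha : ∀ x y, p x → p y → p (x + y)) (hs : ∀ (c : ℚ) x, p x → p (c • x)) : p x := by
  induction x using MonoidAlgebra.induction_on with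
  | of D => exact hg D
  | add x y hx hy => exact ha x y hx hy
  | smul c x hx => exact hs c x hx

/-- A single trivalent vertex, with incident edges `a`, `b`, `c` in cyclic order. -/
def vert (a b c : ℕ) : Comb := gen ⟨{(a, b, c)}, [], 0⟩
/-- A single entry (a leg or a disc). -/
def ent (x : Entry) : Comb := gen ⟨0, [x], 0⟩
/-- A single special vertex, at the end of the edge `e`. -/
def iotaEnd (e : ℕ) : Comb := gen ⟨0, [], {e}⟩

/-- The local relations: the orientation of a vertex is only a cyclic order; AS (which includes
that a diagram with a loop at a vertex vanishes); IHX, in its cyclic form, the edge `x` joining two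
trivalent vertices; and the graded permutation of two neighbouring entries, which is allowed unless
both are legs on the non-commutative line. -/
inductive LocalRel : Comb → Prop
  | rotate (a b c : ℕ) : LocalRel (vert a b c - vert b c a)
  | antisymm (a b c : ℕ) : LocalRel (vert a b c + vert b a c)
  | ihx (a b c d x : ℕ) :
      LocalRel (vert a b x * vert x c d + vert b c x * vert x a d + vert c a x * vert x b d)
  | perm (x y : Entry) (h : ¬(x.OnNC ∧ y.OnNC)) :
      LocalRel (ent x * ent y - ((-1 : ℚ) ^ (x.deg * y.deg)) • (ent y * ent x))

/-- All relations: a diagram does not depend on the names of its edges (isomorphic diagrams are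
equal), and the local relations hold inside any surrounding diagram. -/
inductive Rel : Comb → Prop
  | relabel (f : ℕ → ℕ) (hf : Function.Injective f) (D : PreDiagram) :
      Rel (gen D - gen (D.relabel f))
  | loc (A B : PreDiagram) (g : Comb) (hg : LocalRel g) : Rel (gen A * g * gen B)

/-- Formal linear combinations of diagrams of type `κ` and grade `i` with `k` special vertices. -/
def diagrams (κ : Kind) (k : ℕ) (i : ℤ) : Submodule ℚ Comb :=
  Submodule.span ℚ (gen '' {D | IsDiagram κ k i D})

/-- The span of the relations among diagrams of the given type, grade and number of special
vertices. -/
def relations (κ : Kind) (k : ℕ) (i : ℤ) : Submodule ℚ (diagrams κ k i) :=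
  Submodule.span ℚ {r | Rel (r : Comb)}

/-- Formal linear combinations of diagrams modulo the relations. For type `W` no permutation
relation applies. -/
abbrev Space (κ : Kind) (k : ℕ) (i : ℤ) : Type := diagrams κ k i ⧸ relations κ k i

/-! ### Facts needed to define maps on the quotients -/

/-- The span of all relations between pre-diagrams. -/
def relSpan : Submodule ℚ Comb := Submodule.span ℚ {r | Rel r}

theorem gen_mem {κ : Kind} {k : ℕ} {i : ℤ} {D : PreDiagram} (h : IsDiagram κ k i D) :
    gen D ∈ diagrams κ k i := Submodule.subset_span ⟨D, h, rfl⟩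

theorem isDiagram_congr {κ : Kind} {k : ℕ} {i : ℤ} {D E : PreDiagram}
    (hn : D.names = E.names) (hw : D.word.Perm E.word) (he : D.ends.card = E.ends.card)
    (h : IsDiagram κ k i D) : IsDiagram κ k i E where
  allows x hx := h.allows x (hw.mem_iff.2 hx)
  card_ends := he ▸ h.card_ends
  deg_eq := by
    rw [← h.deg_eq, PreDiagram.deg, PreDiagram.deg, (hw.map Entry.deg).sum_eq]
  count_names := hn ▸ h.count_names

theorem names_mul (A B : PreDiagram) : (A * B).names = A.names + B.names := by
  simp only [PreDiagram.names, PreDiagram.mul_def, Multiset.map_add, Multiset.sum_add,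
    List.map_append, List.sum_append]
  abel

theorem isDiagram_local {κ : Kind} {k : ℕ} {i : ℤ} {C D : PreDiagram} (A B : PreDiagram)
    (hn : C.names = D.names) (hw : C.word.Perm D.word) (he : C.ends.card = D.ends.card) :
    IsDiagram κ k i (A * C * B) ↔ IsDiagram κ k i (A * D * B) := by
  have key : ∀ {C D : PreDiagram}, C.names = D.names → C.word.Perm D.word →
      C.ends.card = D.ends.card → IsDiagram κ k i (A * C * B) → IsDiagram κ k i (A * D * B) := by
    intro C D hn hw he h
    refine isDiagram_congr ?_ ?_ ?_ h
    · simp only [names_mul, hn]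
    · exact (hw.append_left A.word).append_right B.word
    · simp only [PreDiagram.mul_def, Multiset.card_add, he]
  exact ⟨key hn hw he, key hn.symm hw.symm he.symm⟩

theorem entry_names_relabel (f : ℕ → ℕ) (x : Entry) : (x.relabel f).names = x.names.map f := by
  cases x <;> simp [Entry.names, Entry.relabel]

theorem names_relabel (f : ℕ → ℕ) (D : PreDiagram) : (D.relabel f).names = D.names.map f := by
  have h1 : ∀ s : Multiset (ℕ × ℕ × ℕ),
      ((s.map fun v => (f v.1, f v.2.1, f v.2.2)).map
        fun v => ({v.1, v.2.1, v.2.2} : Multiset ℕ)).sum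
        = ((s.map fun v => ({v.1, v.2.1, v.2.2} : Multiset ℕ)).sum).map f := by
    intro s
    induction s using Multiset.induction_on with
    | empty => simp
    | cons a s ih => simp only [Multiset.map_cons, Multiset.sum_cons, ih, Multiset.map_add]; simp
  have h2 : ∀ w : List Entry, ((w.map (Entry.relabel f)).map Entry.names).sum
      = ((w.map Entry.names).sum).map f := by
    intro w
    induction w with
    | nil => simp
    | cons a s ih => simp only [List.map_cons, List.sum_cons, ih, Multiset.map_add,
        entry_names_relabel]
  simp only [PreDiagram.names, PreDiagram.relabel, h1, h2, Multiset.map_add]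

theorem isDiagram_relabel {κ : Kind} {k : ℕ} {i : ℤ} (f : ℕ → ℕ) (hf : Function.Injective f)
    (D : PreDiagram) : IsDiagram κ k i (D.relabel f) ↔ IsDiagram κ k i D := by
  have hal : ∀ x : Entry, κ.Allows (x.relabel f) ↔ κ.Allows x := by
    intro x; cases κ <;> cases x <;> simp [Kind.Allows, Entry.relabel, Entry.OnNC, Entry.isLeg]
  have hdeg : (D.relabel f).deg = D.deg := by
    simp only [PreDiagram.deg, PreDiagram.relabel, List.map_map]
    congr 1
    apply List.map_congr_left
    intro x _; cases x <;> rfl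
  constructor
  · intro h
    refine ⟨fun x hx => (hal x).1 (h.allows _ (List.mem_map_of_mem hx)), ?_, ?_, ?_⟩
    · simpa [PreDiagram.relabel] using h.card_ends
    · rw [← hdeg]; exact h.deg_eq
    · intro e he
      have := h.count_names (f e) (by rw [names_relabel]; exact Multiset.mem_map_of_mem f he)
      rwa [names_relabel, Multiset.count_map_eq_count' f _ hf] at this
  · intro h
    refine ⟨?_, ?_, ?_, ?_⟩
    · intro x hx
      obtain ⟨y, hy, rfl⟩ := List.mem_map.1 hx
      exact (hal y).2 (h.allows y hy)
    · simpa [PreDiagram.relabel] using h.card_ends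
    · rw [hdeg]; exact h.deg_eq
    · intro e he
      rw [names_relabel] at he ⊢
      obtain ⟨a, ha, rfl⟩ := Multiset.mem_map.1 he
      rw [Multiset.count_map_eq_count' f _ hf]
      exact h.count_names a ha

open Classical in
/-- The projection of formal combinations of pre-diagrams onto those of diagrams. -/
def proj (κ : Kind) (k : ℕ) (i : ℤ) : Comb →ₗ[ℚ] diagrams κ k i :=
  linExt fun D => if h : IsDiagram κ k i D then ⟨gen D, gen_mem h⟩ else 0

theorem proj_gen_of {κ : Kind} {k : ℕ} {i : ℤ} {D : PreDiagram} (h : IsDiagram κ k i D) :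
    proj κ k i (gen D) = ⟨gen D, gen_mem h⟩ := by
  rw [proj, linExt_gen, dif_pos h]

theorem proj_gen_of_not {κ : Kind} {k : ℕ} {i : ℤ} {D : PreDiagram} (h : ¬IsDiagram κ k i D) :
    proj κ k i (gen D) = 0 := by
  rw [proj, linExt_gen, dif_neg h]

theorem proj_coe {κ : Kind} {k : ℕ} {i : ℤ} (x : Comb) (hx : x ∈ diagrams κ k i) :
    proj κ k i x = ⟨x, hx⟩ := by
  apply Subtype.ext
  induction hx using Submodule.span_induction with
  | mem x h => obtain ⟨D, hD, rfl⟩ := h; rw [proj_gen_of hD]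
  | zero => simp
  | add x y _ _ hx hy => simp [hx, hy]
  | smul c x _ hx => simp [hx]

theorem proj_rel {κ : Kind} {k : ℕ} {i : ℤ} (r : Comb) (hr : Rel r) :
    proj κ k i r ∈ relations κ k i := by
  suffices h : proj κ k i r = 0 ∨ (proj κ k i r : Comb) = r by
    rcases h with h | h
    · rw [h]; exact zero_mem _
    · exact Submodule.subset_span (by simpa [h] using hr)
  have two : ∀ (D E : PreDiagram) (c : ℚ), (IsDiagram κ k i D ↔ IsDiagram κ k i E) →
      proj κ k i (gen D + c • gen E) = 0
        ∨ (proj κ k i (gen D + c • gen E) : Comb) = gen D + c • gen E := by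
    intro D E c h
    by_cases hD : IsDiagram κ k i D
    · right
      rw [map_add, map_smul, proj_gen_of hD, proj_gen_of (h.1 hD)]; rfl
    · left
      rw [map_add, map_smul, proj_gen_of_not hD, proj_gen_of_not (fun h' => hD (h.2 h'))]; simp
  have nv : ∀ a b c : ℕ, PreDiagram.names ⟨{(a, b, c)}, [], 0⟩ = {a} + {b} + {c} := by
    intro a b c
    simp [PreDiagram.names, Multiset.insert_eq_cons, ← Multiset.singleton_add, add_assoc]
  have nv2 : ∀ a b c d e f : ℕ, PreDiagram.names (⟨{(a, b, c)}, [], 0⟩ * ⟨{(d, e, f)}, [], 0⟩)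
      = {a} + {b} + {c} + ({d} + {e} + {f}) := by
    intro a b c d e f; rw [names_mul, nv, nv]
  cases hr with
  | relabel f hf D =>
    have := two D (D.relabel f) (-1) (isDiagram_relabel f hf D).symm
    simpa [sub_eq_add_neg] using this
  | loc A B g hg =>
    cases hg with
    | rotate a b c =>
      have := two (A * ⟨{(a, b, c)}, [], 0⟩ * B) (A * ⟨{(b, c, a)}, [], 0⟩ * B) (-1)
        (isDiagram_local A B (by rw [nv, nv]; abel) (List.Perm.refl _) rfl)
      simpa [sub_eq_add_neg, mul_add, add_mul, vert] using this
    | antisymm a b c =>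
      have := two (A * ⟨{(a, b, c)}, [], 0⟩ * B) (A * ⟨{(b, a, c)}, [], 0⟩ * B) 1
        (isDiagram_local A B (by rw [nv, nv]; abel) (List.Perm.refl _) rfl)
      simpa [mul_add, add_mul, vert] using this
    | ihx a b c d x =>
      have e1 := isDiagram_local (κ := κ) (k := k) (i := i)
        (C := ⟨{(a, b, x)}, [], 0⟩ * ⟨{(x, c, d)}, [], 0⟩)
        (D := ⟨{(b, c, x)}, [], 0⟩ * ⟨{(x, a, d)}, [], 0⟩) A B
        (by rw [nv2, nv2]; abel) (List.Perm.refl _) rfl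
      have e2 := isDiagram_local (κ := κ) (k := k) (i := i)
        (C := ⟨{(a, b, x)}, [], 0⟩ * ⟨{(x, c, d)}, [], 0⟩)
        (D := ⟨{(c, a, x)}, [], 0⟩ * ⟨{(x, b, d)}, [], 0⟩) A B
        (by rw [nv2, nv2]; abel) (List.Perm.refl _) rfl
      simp only [vert, ← map_mul, mul_add, add_mul, map_add]
      by_cases h : IsDiagram κ k i
          (A * (⟨{(a, b, x)}, [], 0⟩ * ⟨{(x, c, d)}, [], 0⟩) * B)
      · right
        rw [proj_gen_of h, proj_gen_of (e1.1 h), proj_gen_of (e2.1 h)]; rfl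
      · left
        rw [proj_gen_of_not h, proj_gen_of_not (fun h' => h (e1.2 h')),
          proj_gen_of_not (fun h' => h (e2.2 h'))]; simp
    | perm x y h =>
      have := two (A * ⟨0, [x, y], 0⟩ * B) (A * ⟨0, [y, x], 0⟩ * B)
        (-(-1) ^ (x.deg * y.deg))
        (isDiagram_local A B (by simp [PreDiagram.names, add_comm]) (List.Perm.swap _ _ _) rfl)
      have e : ∀ x y : Entry, ent x * ent y = gen ⟨0, [x, y], 0⟩ := by
        intro x y; rw [ent, ent, ← map_mul]; rfl
      rw [e, e]
      simpa [mul_sub, sub_mul, sub_eq_add_neg, mul_add, add_mul] using this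

theorem mem_relations {κ : Kind} {k : ℕ} {i : ℤ} (x : Comb) (hx : x ∈ diagrams κ k i)
    (h : x ∈ relSpan) : (⟨x, hx⟩ : diagrams κ k i) ∈ relations κ k i := by
  rw [← proj_coe x hx]
  clear hx
  induction h using Submodule.span_induction with
  | mem x h => exact proj_rel x h
  | zero => simp
  | add x y _ _ hx hy => rw [map_add]; exact add_mem hx hy
  | smul c x _ hx => rw [map_smul]; exact Submodule.smul_mem _ _ hx

theorem map_mem_relSpan (F : Comb →ₗ[ℚ] Comb) (hR : ∀ r, Rel r → F r ∈ relSpan) (x : Comb)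
    (h : x ∈ relSpan) : F x ∈ relSpan := by
  induction h using Submodule.span_induction with
  | mem x h => exact hR x h
  | zero => simp
  | add x y _ _ hx hy => rw [map_add]; exact add_mem hx hy
  | smul c x _ hx => rw [map_smul]; exact Submodule.smul_mem _ _ hx

/-- The linear map between spaces of diagrams induced by a linear map on formal combinations that
sends diagrams of the source type to combinations of diagrams of the target type and respects the
relations. -/
def induced {κ κ' : Kind} {k k' : ℕ} {i i' : ℤ} (F : Comb →ₗ[ℚ] Comb)
    (hV : ∀ D, IsDiagram κ k i D → F (gen D) ∈ diagrams κ' k' i')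
    (hR : ∀ r, Rel r → F r ∈ relSpan) : Space κ k i →ₗ[ℚ] Space κ' k' i' :=
  have hV' : ∀ x ∈ diagrams κ k i, F x ∈ diagrams κ' k' i' := fun x hx => by
    have : diagrams κ k i ≤ (diagrams κ' k' i').comap F :=
      Submodule.span_le.2 (by rintro _ ⟨D, hD, rfl⟩; exact hV D hD)
    exact this hx
  Submodule.mapQ (relations κ k i) (relations κ' k' i') (F.restrict hV')
    (Submodule.span_le.2 fun r hr => mem_relations _ (hV' _ r.2) (hR _ hr))

/-! ### Substitution operators -/

/-- The formal linear differential operator of odd grade with substitution rule `f`: the operator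
is pushed from left to right through the entries; at each entry `x` it produces the term in which
`x` is replaced by `f x`, plus `(-1)^deg x` times the term where it has moved past `x`. -/
def oddExt (f : Entry → Comb) : List Entry → Comb
  | [] => 0
  | x :: w => f x * gen ⟨0, w, 0⟩ + x.sgn • (ent x * oddExt f w)

/-- Replace every entry `x` by `f x`. -/
def multExt (f : Entry → Comb) (w : List Entry) : Comb := (w.map f).prod

/-- Apply an operation on sequences of entries to a diagram, keeping the rest of the graph. -/
def wordOp (E : List Entry → Comb) (D : PreDiagram) : Comb :=
  gen ⟨D.verts, [], D.ends⟩ * E D.word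

/-- The differential: a grade 1 leg becomes a grade 2 leg on the same line, a hollow disc becomes a
filled disc, and grade 2 legs and filled discs go to zero. -/
def dRule : Entry → Comb
  | .leg1 l e => ent (.leg2 l e)
  | .leg2 _ _ => 0
  | .hollow => ent .filled
  | .filled => 0

/-- The map `ι`: the end of a grade 1 leg is taken off its line and becomes the special vertex. A
grade 2 leg, ending the edge `e`, is replaced by a trivalent vertex with, in cyclic order, the edge
`e`, an edge `0` to the special vertex and an edge `1` ending in a grade 1 leg on the same line.
(This is applied to diagrams where the names `0` and `1` are not in use.) -/
def iotaRule : Entry → Comb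
  | .leg1 _ e => iotaEnd e
  | .leg2 l e => vert e 0 1 * iotaEnd 0 * ent (.leg1 l 1)
  | .hollow => 0
  | .filled => 0

/-- Put every leg on the commutative line. -/
def commRule : Entry → Comb
  | .leg1 _ e => ent (.leg1 .com e)
  | .leg2 _ e => ent (.leg2 .com e)
  | .hollow => ent .hollow
  | .filled => ent .filled

/-- The rule of `θ` for legs on the non-commutative line, with `t` for a hollow and `dt` for a filled
disc: a grade 1 leg goes to `t` times the leg plus `1 - t` times the same leg on the commutative
line, and a grade 2 leg goes to the differential of this. Other entries do not occur in the
diagrams to which `θ` is applied; they are left alone. -/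
def thetaRule : Entry → Comb
  | .leg1 .nc e => ent (.leg1 .nc e) * ent .hollow + ent (.leg1 .com e)
      - ent (.leg1 .com e) * ent .hollow
  | .leg2 .nc e => ent (.leg2 .nc e) * ent .hollow - ent (.leg1 .nc e) * ent .filled
      + ent (.leg2 .com e) - ent (.leg2 .com e) * ent .hollow + ent (.leg1 .com e) * ent .filled
  | x => ent x

/-- The sign for moving the first filled disc to the far left. -/
def signBefore : List Entry → ℚ
  | [] => 1
  | x :: w => if x = Entry.filled then 1 else x.sgn * signBefore w

/-- The coefficient in the formal integral: zero unless there is precisely one filled disc; then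
the sign for moving this disc to the far left, times `1 / (n + 1)`, where `n` is the number of hollow
discs. -/
def intCoeff (w : List Entry) : ℚ :=
  if w.count Entry.filled = 1 then signBefore w / ((w.count Entry.hollow : ℚ) + 1) else 0

/-- The formal integral: remove all discs and multiply by the coefficient `intCoeff`. -/
def intWord (w : List Entry) : Comb := intCoeff w • gen ⟨0, w.filter Entry.isLeg, 0⟩

def dLin : Comb →ₗ[ℚ] Comb := linExt (wordOp (oddExt dRule))
/-- Edge names are first shifted by 2 so that `0` and `1` are not in use. -/
def iotaLin : Comb →ₗ[ℚ] Comb := linExt fun D => wordOp (oddExt iotaRule) (D.relabel (· + 2))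
def commLin : Comb →ₗ[ℚ] Comb := linExt (wordOp (multExt commRule))
def thetaLin : Comb →ₗ[ℚ] Comb := linExt (wordOp (multExt thetaRule))
def intLin : Comb →ₗ[ℚ] Comb := linExt (wordOp intWord)

/-! #### Combinations that vanish inside any surrounding diagram -/

/-- The combinations that vanish modulo relations inside any surrounding diagram. -/
def locSub : Submodule ℚ Comb where
  carrier := {g | ∀ p q : Comb, p * g * q ∈ relSpan}
  add_mem' {a b} ha hb p q := by
    rw [mul_add, add_mul]; exact add_mem (ha p q) (hb p q)
  zero_mem' p q := by simp
  smul_mem' c x hx p q := by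
    rw [mul_smul_comm, smul_mul_assoc]; exact Submodule.smul_mem _ _ (hx p q)

theorem loc_of_localRel {g : Comb} (hg : LocalRel g) : g ∈ locSub := by
  intro p q
  induction p using Comb.induction with
  | _h0 => simp
  | ha x y hx hy => rw [add_mul, add_mul]; exact add_mem hx hy
  | hs c x hx => rw [smul_mul_assoc, smul_mul_assoc]; exact Submodule.smul_mem _ _ hx
  | hg A =>
    induction q using Comb.induction with
    | _h0 => simp
    | ha x y hx hy => rw [mul_add]; exact add_mem hx hy
    | hs c x hx => rw [mul_smul_comm]; exact Submodule.smul_mem _ _ hx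
    | hg B => exact Submodule.subset_span (Rel.loc A B g hg)

theorem loc_mul {g : Comb} (hg : g ∈ locSub) (p q : Comb) : p * g * q ∈ locSub := by
  intro p' q'
  have := hg (p' * p) (q * q')
  simpa only [mul_assoc] using this

theorem relSpan_of_loc {g : Comb} (hg : g ∈ locSub) : g ∈ relSpan := by
  simpa using hg 1 1

/-- Commutation up to the sign `s`, modulo relations. -/
def GC (s : ℚ) (a b : Comb) : Prop := a * b - s • (b * a) ∈ locSub

theorem GC.mul {s t : ℚ} {a a' b : Comb} (h : GC s a b) (h' : GC t a' b) :
    GC (s * t) (a * a') b := by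
  have h1 := loc_mul h' a 1
  have h2 := Submodule.smul_mem _ t (loc_mul h 1 a')
  have := add_mem h1 h2
  unfold GC
  convert this using 1
  simp only [mul_sub, sub_mul, mul_one, one_mul, mul_smul_comm, smul_mul_assoc, smul_sub,
    smul_smul, mul_assoc, mul_comm s t]
  abel

theorem GC.add {s : ℚ} {a a' b : Comb} (h : GC s a b) (h' : GC s a' b) : GC s (a + a') b := by
  have := add_mem h h'
  unfold GC
  convert this using 1
  simp only [mul_add, add_mul, smul_add]
  abel

theorem GC.sub {s : ℚ} {a a' b : Comb} (h : GC s a b) (h' : GC s a' b) : GC s (a - a') b := by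
  have := sub_mem h h'
  unfold GC
  convert this using 1
  simp only [mul_sub, sub_mul, smul_sub]
  abel

theorem GC.symm {s : ℚ} {a b : Comb} (hs : s * s = 1) (h : GC s a b) : GC s b a := by
  have := Submodule.smul_mem _ (-s) h
  unfold GC
  convert this using 1
  simp only [smul_sub, smul_smul, neg_mul, hs, neg_smul, one_smul]
  abel

theorem GC.zero (s : ℚ) (b : Comb) : GC s 0 b := by simp [GC]

theorem gc_ent {x y : Entry} (h : ¬(x.OnNC ∧ y.OnNC)) {s : ℚ}
    (hs : s = (-1 : ℚ) ^ (x.deg * y.deg)) : GC s (ent x) (ent y) := by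
  subst hs; exact loc_of_localRel (.perm x y h)

theorem gc_vert (a b c : ℕ) (y : Entry) : GC 1 (vert a b c) (ent y) := by
  have : vert a b c * ent y = ent y * vert a b c := by
    simp only [vert, ent, ← map_mul, PreDiagram.mul_def]; simp
  simp [GC, this]

theorem gc_iotaEnd (a : ℕ) (y : Entry) : GC 1 (iotaEnd a) (ent y) := by
  have : iotaEnd a * ent y = ent y * iotaEnd a := by
    simp only [iotaEnd, ent, ← map_mul, PreDiagram.mul_def]; simp
  simp [GC, this]

theorem sgn_mul_self (n : ℕ) : ((-1 : ℚ) ^ n) * (-1) ^ n = 1 := by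
  rw [← mul_pow]; simp


theorem sgn_eq (x : Entry) (n : ℕ) : x.sgn ^ n = (-1 : ℚ) ^ (x.deg * n) := by
  rw [Entry.sgn, pow_mul]

/-! #### Renaming -/

/-- Renaming as a homomorphism. -/
def relabelHom (f : ℕ → ℕ) : PreDiagram →* PreDiagram where
  toFun := PreDiagram.relabel f
  map_one' := by simp [PreDiagram.relabel, PreDiagram.one_def]
  map_mul' A B := by simp [PreDiagram.relabel, PreDiagram.mul_def]

/-- Renaming, extended linearly. -/
def relabelAlg (f : ℕ → ℕ) : Comb →ₐ[ℚ] Comb :=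
  MonoidAlgebra.mapDomainAlgHom ℚ ℚ (relabelHom f)

theorem relabelAlg_gen (f : ℕ → ℕ) (D : PreDiagram) :
    relabelAlg f (gen D) = gen (D.relabel f) := by
  simp [relabelAlg, gen, relabelHom]
  rfl

theorem relabelAlg_vert (f : ℕ → ℕ) (a b c : ℕ) :
    relabelAlg f (vert a b c) = vert (f a) (f b) (f c) := by
  simp [vert, relabelAlg_gen, PreDiagram.relabel]

theorem relabelAlg_ent (f : ℕ → ℕ) (x : Entry) :
    relabelAlg f (ent x) = ent (x.relabel f) := by
  simp [ent, relabelAlg_gen, PreDiagram.relabel]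

theorem relabelAlg_iotaEnd (f : ℕ → ℕ) (e : ℕ) :
    relabelAlg f (iotaEnd e) = iotaEnd (f e) := by
  simp [iotaEnd, relabelAlg_gen, PreDiagram.relabel]

theorem sub_relabelAlg_mem (f : ℕ → ℕ) (hf : Function.Injective f) (x : Comb) :
    x - relabelAlg f x ∈ relSpan := by
  induction x using Comb.induction with
  | _h0 => simp
  | ha x y hx hy =>
    rw [map_add, add_sub_add_comm]; exact add_mem hx hy
  | hs c x hx => rw [map_smul, ← smul_sub]; exact Submodule.smul_mem _ _ hx
  | hg D => rw [relabelAlg_gen]; exact Submodule.subset_span (Rel.relabel f hf D)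

theorem localRel_relabel (f : ℕ → ℕ) {g : Comb} (hg : LocalRel g) :
    LocalRel (relabelAlg f g) := by
  have hd : ∀ x : Entry, (x.relabel f).deg = x.deg := by intro x; cases x <;> rfl
  have hn : ∀ x : Entry, (x.relabel f).OnNC ↔ x.OnNC := by intro x; cases x <;> exact Iff.rfl
  cases hg with
  | rotate a b c =>
    simp only [map_sub, relabelAlg_vert]; exact .rotate _ _ _
  | antisymm a b c =>
    simp only [map_add, relabelAlg_vert]; exact .antisymm _ _ _
  | ihx a b c d x =>
    simp only [map_add, map_mul, relabelAlg_vert]; exact .ihx _ _ _ _ _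
  | perm x y h =>
    simp only [map_sub, map_mul, map_smul, relabelAlg_ent]
    have := LocalRel.perm (x.relabel f) (y.relabel f) (by rwa [hn, hn])
    rwa [hd, hd] at this

theorem wordOp_relabel (E : List Entry → Comb) (f : ℕ → ℕ) (D : PreDiagram)
    (h : E (D.word.map (Entry.relabel f)) = relabelAlg f (E D.word)) :
    wordOp E (D.relabel f) = relabelAlg f (wordOp E D) := by
  rw [wordOp, wordOp, map_mul, relabelAlg_gen, ← h]
  rfl

theorem oddExt_relabel (r : Entry → Comb) (f : ℕ → ℕ) (w : List Entry)
    (h : ∀ x ∈ w, r (x.relabel f) = relabelAlg f (r x)) :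
    oddExt r (w.map (Entry.relabel f)) = relabelAlg f (oddExt r w) := by
  induction w with
  | nil => simp [oddExt]
  | cons x w ih =>
    have hs : (x.relabel f).sgn = x.sgn := by cases x <;> rfl
    rw [List.map_cons, oddExt, oddExt, map_add, map_mul, map_smul, map_mul, relabelAlg_gen,
      relabelAlg_ent, h x (by simp), ih (fun y hy => h y (by simp [hy])), hs]
    simp [PreDiagram.relabel]

theorem multExt_relabel (r : Entry → Comb) (f : ℕ → ℕ) (w : List Entry)
    (h : ∀ x, r (x.relabel f) = relabelAlg f (r x)) :
    multExt r (w.map (Entry.relabel f)) = relabelAlg f (multExt r w) := by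
  induction w with
  | nil => simp [multExt]
  | cons x w ih =>
    simp only [multExt, List.map_cons, List.prod_cons, map_mul] at ih ⊢
    rw [h, ih]

/-! #### Compatibility with the local relations -/

theorem wordOp_vert (E : List Entry → Comb) (s : Multiset (ℕ × ℕ × ℕ)) (A B : PreDiagram) :
    wordOp E (A * ⟨s, [], 0⟩ * B) = gen ⟨s, [], 0⟩ * wordOp E (A * B) := by
  rw [wordOp, wordOp, ← mul_assoc, ← map_mul]
  simp only [PreDiagram.mul_def, List.append_nil, add_zero, zero_add]
  rw [add_comm A.verts s, add_assoc]

theorem wordOp_loc (E : List Entry → Comb)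
    (hE : ∀ (u w : List Entry) (x y : Entry), ¬(x.OnNC ∧ y.OnNC) →
      E (u ++ x :: y :: w) - ((-1 : ℚ) ^ (x.deg * y.deg)) • E (u ++ y :: x :: w) ∈ locSub)
    (A B : PreDiagram) (g : Comb) (hg : LocalRel g) :
    linExt (wordOp E) (gen A * g * gen B) ∈ relSpan := by
  have hg' := loc_of_localRel hg
  cases hg with
  | rotate a b c =>
    have := hg' 1 (wordOp E (A * B))
    simpa only [vert, mul_sub, sub_mul, ← map_mul, map_sub, linExt_gen, wordOp_vert, one_mul]
      using this
  | antisymm a b c =>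
    have := hg' 1 (wordOp E (A * B))
    simpa only [vert, mul_add, add_mul, ← map_mul, map_add, linExt_gen, wordOp_vert, one_mul]
      using this
  | ihx a b c d x =>
    have := hg' 1 (wordOp E (A * B))
    have e : ∀ a b c a' b' c' : ℕ, (⟨{(a, b, c)}, [], 0⟩ * ⟨{(a', b', c')}, [], 0⟩ : PreDiagram)
      = ⟨{(a, b, c)} + {(a', b', c')}, [], 0⟩ := by intros; rfl
    simpa only [vert, mul_add, add_mul, ← map_mul, map_add, linExt_gen, wordOp_vert, one_mul, e]
      using this
  | perm x y h =>
    have := hE A.word B.word x y h (gen ⟨A.verts + B.verts, [], A.ends + B.ends⟩) 1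
    have e : ∀ x y : Entry, ent x * ent y = gen ⟨0, [x, y], 0⟩ := by
      intro x y; rw [ent, ent, ← map_mul]; rfl
    simp only [e, mul_sub, sub_mul, mul_smul_comm, smul_mul_assoc, ← map_mul, map_sub, map_smul,
      linExt_gen]
    simpa [wordOp, PreDiagram.mul_def, mul_sub] using this

theorem ent_mul_gen (x : Entry) (w : List Entry) :
    ent x * gen ⟨0, w, 0⟩ = gen ⟨0, x :: w, 0⟩ := by
  rw [ent, ← map_mul]; rfl

theorem gen_append (u w : List Entry) :
    gen ⟨0, u ++ w, 0⟩ = gen ⟨0, u, 0⟩ * gen ⟨0, w, 0⟩ := by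
  rw [← map_mul]; rfl

theorem oddExt_append_sub (r : Entry → Comb) (u : List Entry) (c : ℚ) (v w : List Entry)
    (h1 : oddExt r v - c • oddExt r w ∈ locSub)
    (h2 : gen ⟨0, v, 0⟩ - c • gen ⟨0, w, 0⟩ ∈ locSub) :
    oddExt r (u ++ v) - c • oddExt r (u ++ w) ∈ locSub := by
  induction u with
  | nil => exact h1
  | cons z u ih =>
    have a1 := loc_mul h2 (r z * gen ⟨0, u, 0⟩) 1
    have a2 := Submodule.smul_mem _ z.sgn (loc_mul ih (ent z) 1)
    have := add_mem a1 a2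
    simp only [List.cons_append, oddExt, gen_append]
    convert this using 1
    simp only [mul_sub, mul_one, mul_smul_comm, smul_sub, smul_add, mul_assoc,
      smul_comm c z.sgn]
    abel

theorem oddExt_perm (r : Entry → Comb)
    (hr : ∀ x y : Entry, ¬(x.OnNC ∧ y.OnNC) →
      GC ((-1 : ℚ) ^ ((x.deg + 1) * y.deg)) (r x) (ent y))
    (u w : List Entry) (x y : Entry) (h : ¬(x.OnNC ∧ y.OnNC)) :
    oddExt r (u ++ x :: y :: w) - ((-1 : ℚ) ^ (x.deg * y.deg)) • oddExt r (u ++ y :: x :: w)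
      ∈ locSub := by
  have h' : ¬(y.OnNC ∧ x.OnNC) := fun h'' => h h''.symm
  have hxy := loc_of_localRel (LocalRel.perm x y h)
  apply oddExt_append_sub
  · have a1 := loc_mul (hr x y h) 1 (gen ⟨0, w, 0⟩)
    have a2 := Submodule.smul_mem _ (-((-1 : ℚ) ^ (x.deg * y.deg)))
      (loc_mul (hr y x h') 1 (gen ⟨0, w, 0⟩))
    have a3 := Submodule.smul_mem _ ((-1 : ℚ) ^ (x.deg + y.deg))
      (loc_mul hxy 1 (oddExt r w))
    have := add_mem (add_mem a1 a2) a3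
    convert this using 1
    simp only [oddExt, ← ent_mul_gen, Entry.sgn, one_mul, mul_add, mul_smul_comm, smul_add,
      smul_sub, sub_mul, smul_mul_assoc, mul_assoc, smul_smul]
    have i1 : (-1 : ℚ) ^ x.deg * (-1) ^ x.deg = 1 := sgn_mul_self _
    have i3 : (-1 : ℚ) ^ (x.deg * y.deg) * (-1) ^ (x.deg * y.deg) = 1 := sgn_mul_self _
    have e1 : (-1 : ℚ) ^ ((x.deg + 1) * y.deg) = (-1) ^ (x.deg * y.deg) * (-1) ^ y.deg := by
      rw [add_mul, one_mul, pow_add]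
    have e2 : (-1 : ℚ) ^ ((y.deg + 1) * x.deg) = (-1) ^ (x.deg * y.deg) * (-1) ^ x.deg := by
      rw [add_mul, one_mul, pow_add, mul_comm y.deg]
    have e3 : -((-1 : ℚ) ^ (x.deg * y.deg)) * ((-1) ^ (x.deg * y.deg) * (-1) ^ x.deg)
        = -(-1) ^ x.deg := by rw [neg_mul, ← mul_assoc, i3, one_mul]
    rw [e1, e2, e3, pow_add]
    simp only [neg_smul, mul_comm]
    abel
  · have := loc_mul hxy 1 (gen ⟨0, w, 0⟩)
    convert this using 1
    simp only [one_mul, sub_mul, smul_mul_assoc, mul_assoc, ent_mul_gen]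

theorem multExt_perm (r : Entry → Comb)
    (hr : ∀ x y : Entry, ¬(x.OnNC ∧ y.OnNC) → GC ((-1 : ℚ) ^ (x.deg * y.deg)) (r x) (r y))
    (u w : List Entry) (x y : Entry) (h : ¬(x.OnNC ∧ y.OnNC)) :
    multExt r (u ++ x :: y :: w) - ((-1 : ℚ) ^ (x.deg * y.deg)) • multExt r (u ++ y :: x :: w)
      ∈ locSub := by
  have := loc_mul (hr x y h) (multExt r u) (multExt r w)
  convert this using 1
  simp only [multExt, List.map_append, List.map_cons, List.prod_append, List.prod_cons,
    mul_sub, sub_mul, mul_smul_comm, smul_mul_assoc, mul_assoc]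

theorem dRule_gc (x y : Entry) (h : ¬(x.OnNC ∧ y.OnNC)) :
    GC ((-1 : ℚ) ^ ((x.deg + 1) * y.deg)) (dRule x) (ent y) := by
  cases x with
  | leg1 l e => exact gc_ent (x := .leg2 l e) h rfl
  | leg2 l e => exact GC.zero _ _
  | hollow => exact gc_ent (x := .filled) h rfl
  | filled => exact GC.zero _ _

theorem iotaRule_gc (x y : Entry) (h : ¬(x.OnNC ∧ y.OnNC)) :
    GC ((-1 : ℚ) ^ ((x.deg + 1) * y.deg)) (iotaRule x) (ent y) := by
  cases x with
  | leg1 l e =>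
    have : (-1 : ℚ) ^ (((Entry.leg1 l e).deg + 1) * y.deg) = 1 := by
      rw [pow_mul]; simp [Entry.deg]
    rw [this]; exact gc_iotaEnd _ _
  | leg2 l e =>
    have : (-1 : ℚ) ^ (((Entry.leg2 l e).deg + 1) * y.deg)
        = 1 * 1 * (-1) ^ ((Entry.leg1 l 1).deg * y.deg) := by
      rw [pow_mul, pow_mul]; norm_num [Entry.deg]
    rw [this]
    exact ((gc_vert _ _ _ _).mul (gc_iotaEnd _ _)).mul
      (gc_ent (x := .leg1 l 1) h rfl)
  | hollow => exact GC.zero _ _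
  | filled => exact GC.zero _ _

theorem commRule_gc (x y : Entry) :
    GC ((-1 : ℚ) ^ (x.deg * y.deg)) (commRule x) (commRule y) := by
  cases x <;> cases y <;> exact gc_ent (by simp [Entry.OnNC]) rfl

theorem thetaRule_gc_aux (x y : Entry) (h : ¬y.OnNC) :
    GC ((-1 : ℚ) ^ (x.deg * y.deg)) (thetaRule x) (ent y) := by
  have key : ∀ x : Entry, GC ((-1 : ℚ) ^ (x.deg * y.deg)) (ent x) (ent y) := fun x =>
    gc_ent (fun h' => h h'.2) rfl
  have key2 : ∀ (x z : Entry) (n : ℕ), x.deg + z.deg = n →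
      GC ((-1 : ℚ) ^ (n * y.deg)) (ent x * ent z) (ent y) := by
    rintro x z n rfl
    rw [add_mul, pow_add]; exact (key x).mul (key z)
  rcases x with ⟨_ | _, e⟩ | ⟨_ | _, e⟩ | _ | _
  · exact ((key2 _ _ 1 rfl).add (key (.leg1 .com e))).sub (key2 _ _ 1 rfl)
  · exact key _
  · exact ((((key2 _ _ 2 rfl).sub (key2 _ _ 2 rfl)).add (key (.leg2 .com e))).sub
      (key2 _ _ 2 rfl)).add (key2 _ _ 2 rfl)
  · exact key _
  · exact key _
  · exact key _

theorem thetaRule_of_not (y : Entry) (h : ¬y.OnNC) : thetaRule y = ent y := by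
  rcases y with ⟨_ | _, e⟩ | ⟨_ | _, e⟩ | _ | _ <;> first | rfl | exact absurd rfl h

theorem thetaRule_gc (x y : Entry) (h : ¬(x.OnNC ∧ y.OnNC)) :
    GC ((-1 : ℚ) ^ (x.deg * y.deg)) (thetaRule x) (thetaRule y) := by
  by_cases hy : y.OnNC
  · have hx : ¬x.OnNC := fun hx => h ⟨hx, hy⟩
    rw [thetaRule_of_not x hx, mul_comm]
    exact (thetaRule_gc_aux y x hx).symm (sgn_mul_self _)
  · rw [thetaRule_of_not y hy]; exact thetaRule_gc_aux x y hy

theorem intWord_perm (u w : List Entry) (x y : Entry) (h : ¬(x.OnNC ∧ y.OnNC)) :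
    intWord (u ++ x :: y :: w) - ((-1 : ℚ) ^ (x.deg * y.deg)) • intWord (u ++ y :: x :: w)
      ∈ locSub := by
  have hsg : ∀ (u : List Entry), (u ++ x :: y :: w).count Entry.filled = 1 →
      signBefore (u ++ x :: y :: w) =
        (if x = Entry.filled ∨ y = Entry.filled then (-1 : ℚ) ^ (x.deg * y.deg) else 1)
          * signBefore (u ++ y :: x :: w) := by
    intro u
    induction u with
    | nil =>
      intro hc
      cases x <;> cases y <;>
        simp_all [signBefore, Entry.sgn, Entry.deg]
    | cons z u ih =>
      intro hc
      by_cases hz : z = Entry.filled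
      · subst hz
        have hc' : (u ++ x :: y :: w).count Entry.filled = 0 := by
          simpa [List.count_cons] using hc
        have hx : x ≠ Entry.filled := by
          rintro rfl; simp [List.count_append] at hc'
        have hy : y ≠ Entry.filled := by
          rintro rfl; simp [List.count_append, List.count_cons] at hc'
        simp [signBefore, hx, hy]
      · have hc' : (u ++ x :: y :: w).count Entry.filled = 1 := by
          simpa [List.count_cons, hz] using hc
        simp only [List.cons_append, signBefore, hz, if_false, ih hc']
        ring
  have hp : (u ++ x :: y :: w).Perm (u ++ y :: x :: w) :=
    (List.Perm.swap _ _ _).append_left u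
  have hco : intCoeff (u ++ x :: y :: w) =
      (if x = Entry.filled ∨ y = Entry.filled then (-1 : ℚ) ^ (x.deg * y.deg) else 1)
        * intCoeff (u ++ y :: x :: w) := by
    unfold intCoeff
    rw [← hp.count_eq, ← hp.count_eq]
    split_ifs with h1 h2 h2
    · rw [hsg u h1, if_pos h2]; ring
    · rw [hsg u h1, if_neg h2]; ring
    · simp
    · simp
  unfold intWord
  rw [hco]
  by_cases hl : x.isLeg = true ∧ y.isLeg = true
  · have hx : x ≠ Entry.filled := by rintro rfl; simp [Entry.isLeg] at hl
    have hy : y ≠ Entry.filled := by rintro rfl; simp [Entry.isLeg] at hl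
    have := Submodule.smul_mem _ (intCoeff (u ++ y :: x :: w))
      (loc_mul (loc_of_localRel (LocalRel.perm x y h)) (gen ⟨0, u.filter Entry.isLeg, 0⟩)
        (gen ⟨0, w.filter Entry.isLeg, 0⟩))
    convert this using 1
    simp only [List.filter_append, List.filter_cons, hl.1, hl.2, if_true, hx, hy, or_self,
      if_false, one_mul, gen_append, ← ent_mul_gen, mul_sub, sub_mul, mul_smul_comm,
      smul_mul_assoc, smul_sub, mul_assoc]
    rw [smul_comm]
  · have hf : (u ++ x :: y :: w).filter Entry.isLeg = (u ++ y :: x :: w).filter Entry.isLeg := by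
      clear hco hsg hp
      rw [List.filter_append, List.filter_append]
      congr 1
      cases x <;> cases y <;> simp_all [Entry.isLeg, List.filter_cons]
    have ht : (if x = Entry.filled ∨ y = Entry.filled then (-1 : ℚ) ^ (x.deg * y.deg) else 1)
        = (-1 : ℚ) ^ (x.deg * y.deg) := by
      cases x <;> cases y <;> simp_all [Entry.isLeg, Entry.deg]
    rw [hf, ht, smul_smul, sub_self]
    exact zero_mem _

/-! #### All operators respect the relations -/

theorem entry_map_intWord (f : ℕ → ℕ) (w : List Entry) :
    intWord (w.map (Entry.relabel f)) = relabelAlg f (intWord w) := by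
  have h1 : ∀ w : List Entry, signBefore (w.map (Entry.relabel f)) = signBefore w := by
    intro w
    induction w with
    | nil => rfl
    | cons x w ih => cases x <;> simp_all [signBefore, Entry.relabel, Entry.sgn, Entry.deg]
  have h2 : ∀ w : List Entry, (w.map (Entry.relabel f)).count Entry.filled
      = w.count Entry.filled := by
    intro w
    induction w with
    | nil => rfl
    | cons x w ih => cases x <;> simp_all [Entry.relabel]
  have h3 : ∀ w : List Entry, (w.map (Entry.relabel f)).count Entry.hollow
      = w.count Entry.hollow := by
    intro w
    induction w with
    | nil => rfl
    | cons x w ih => cases x <;> simp_all [Entry.relabel]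
  have h4 : ∀ w : List Entry, (w.map (Entry.relabel f)).filter Entry.isLeg
      = (w.filter Entry.isLeg).map (Entry.relabel f) := by
    intro w
    induction w with
    | nil => rfl
    | cons x w ih => cases x <;> simp_all [Entry.relabel, Entry.isLeg, List.filter_cons]
  rw [intWord, intWord, map_smul, relabelAlg_gen, h4]
  simp [intCoeff, h1, h2, h3, PreDiagram.relabel]

theorem wordOp_rel (E : List Entry → Comb)
    (hE : ∀ (u w : List Entry) (x y : Entry), ¬(x.OnNC ∧ y.OnNC) →
      E (u ++ x :: y :: w) - ((-1 : ℚ) ^ (x.deg * y.deg)) • E (u ++ y :: x :: w) ∈ locSub)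
    (hn : ∀ (f : ℕ → ℕ) (w : List Entry), E (w.map (Entry.relabel f)) = relabelAlg f (E w))
    (r : Comb) (hr : Rel r) : linExt (wordOp E) r ∈ relSpan := by
  cases hr with
  | relabel f hf D =>
    rw [map_sub, linExt_gen, linExt_gen, wordOp_relabel E f D (hn f _)]
    exact sub_relabelAlg_mem f hf _
  | loc A B g hg => exact wordOp_loc E hE A B g hg

theorem dRule_relabel (f : ℕ → ℕ) (x : Entry) :
    dRule (x.relabel f) = relabelAlg f (dRule x) := by
  cases x <;> simp [dRule, Entry.relabel, relabelAlg_ent]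

theorem commRule_relabel (f : ℕ → ℕ) (x : Entry) :
    commRule (x.relabel f) = relabelAlg f (commRule x) := by
  cases x <;> simp [commRule, Entry.relabel, relabelAlg_ent]

theorem thetaRule_relabel (f : ℕ → ℕ) (x : Entry) :
    thetaRule (x.relabel f) = relabelAlg f (thetaRule x) := by
  rcases x with ⟨_ | _, e⟩ | ⟨_ | _, e⟩ | _ | _ <;>
    simp [thetaRule, Entry.relabel, relabelAlg_ent]

theorem dLin_rel (r : Comb) (hr : Rel r) : dLin r ∈ relSpan :=
  wordOp_rel _ (oddExt_perm _ dRule_gc)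
    (fun f w => oddExt_relabel _ f w fun x _ => dRule_relabel f x) r hr

theorem commLin_rel (r : Comb) (hr : Rel r) : commLin r ∈ relSpan :=
  wordOp_rel _ (multExt_perm _ fun x y _ => commRule_gc x y)
    (fun f w => multExt_relabel _ f w (commRule_relabel f)) r hr

theorem thetaLin_rel (r : Comb) (hr : Rel r) : thetaLin r ∈ relSpan :=
  wordOp_rel _ (multExt_perm _ thetaRule_gc)
    (fun f w => multExt_relabel _ f w (thetaRule_relabel f)) r hr

theorem intLin_rel (r : Comb) (hr : Rel r) : intLin r ∈ relSpan :=
  wordOp_rel _ intWord_perm entry_map_intWord r hr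

theorem id_rel (r : Comb) (hr : Rel r) : (LinearMap.id : Comb →ₗ[ℚ] Comb) r ∈ relSpan :=
  Submodule.subset_span hr

theorem relabel_relabel (f g : ℕ → ℕ) (D : PreDiagram) :
    (D.relabel f).relabel g = D.relabel (g ∘ f) := by
  have : Entry.relabel g ∘ Entry.relabel f = Entry.relabel (g ∘ f) := by
    funext x; cases x <;> rfl
  simp [PreDiagram.relabel, this]

theorem iotaLin_rel (r : Comb) (hr : Rel r) : iotaLin r ∈ relSpan := by
  cases hr with
  | relabel f hf D =>
    let f' : ℕ → ℕ := fun n => if n < 2 then n else f (n - 2) + 2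
    have hf' : Function.Injective f' := by
      intro a b hab
      simp only [f'] at hab
      split_ifs at hab
      · exact hab
      · omega
      · omega
      · have := hf (Nat.add_right_cancel hab); omega
    have e : (D.relabel f).relabel (· + 2) = (D.relabel (· + 2)).relabel f' := by
      rw [relabel_relabel, relabel_relabel]
      congr 1
    rw [iotaLin, map_sub, linExt_gen, linExt_gen, e,
      wordOp_relabel (oddExt iotaRule) f' (D.relabel (· + 2))]
    · exact sub_relabelAlg_mem f' hf' _
    · apply oddExt_relabel
      intro x hx
      obtain ⟨y, _, rfl⟩ := List.mem_map.1 hx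
      cases y <;> simp [iotaRule, Entry.relabel, relabelAlg_ent, relabelAlg_vert,
        relabelAlg_iotaEnd, f']
  | loc A B g hg =>
    have e : iotaLin = (linExt (wordOp (oddExt iotaRule))).comp
        (relabelAlg (· + 2)).toLinearMap := by
      apply LinearMap.ext
      intro x
      induction x using Comb.induction with
      | _h0 => simp
      | ha x y hx hy => simp only [map_add, hx, hy]
      | hs c x hx => simp only [map_smul, hx]
      | hg D =>
        rw [iotaLin, linExt_gen, LinearMap.comp_apply, AlgHom.toLinearMap_apply, relabelAlg_gen,
          linExt_gen]
    rw [e, LinearMap.comp_apply, AlgHom.toLinearMap_apply, map_mul (relabelAlg _),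
      map_mul (relabelAlg _), relabelAlg_gen, relabelAlg_gen]
    exact wordOp_loc _ (oddExt_perm _ iotaRule_gc) _ _ _ (localRel_relabel _ hg)

/-! #### All operators send diagrams to combinations of diagrams -/

theorem oddExt_mem (V : Submodule ℚ Comb) (Q : PreDiagram → Prop) (f : Entry → Comb)
    (h : ∀ A B x, Q (A * ⟨0, [x], 0⟩ * B) → gen A * f x * gen B ∈ V) (w : List Entry) :
    ∀ A, Q (A * ⟨0, w, 0⟩) → gen A * oddExt f w ∈ V := by
  induction w with
  | nil => intro A _; simp [oddExt]
  | cons x w ih =>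
    intro A hA
    have e : A * ⟨0, x :: w, 0⟩ = A * ⟨0, [x], 0⟩ * ⟨0, w, 0⟩ := by
      simp [PreDiagram.mul_def]
    rw [e] at hA
    have h1 := h _ _ _ hA
    have h2 := ih _ hA
    rw [oddExt, mul_add, mul_smul_comm, ← mul_assoc, ← mul_assoc]
    rw [map_mul] at h2
    exact add_mem h1 (Submodule.smul_mem _ _ h2)

theorem multExt_mem (V : Submodule ℚ Comb) (Q : PreDiagram → Prop) (hV : ∀ D, Q D → gen D ∈ V)
    (f : Entry → Comb)
    (h : ∀ x, f x ∈ Submodule.span ℚ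
      (gen '' {C | ∀ A B, Q (A * ⟨0, [x], 0⟩ * B) → Q (A * C * B)})) (w : List Entry) :
    ∀ A, Q (A * ⟨0, w, 0⟩) → gen A * multExt f w ∈ V := by
  induction w with
  | nil =>
    intro A hA
    have e : A * ⟨0, [], 0⟩ = A := mul_one A
    rw [e] at hA
    simpa [multExt] using hV _ hA
  | cons x w ih =>
    intro A hA
    have e : A * ⟨0, x :: w, 0⟩ = A * ⟨0, [x], 0⟩ * ⟨0, w, 0⟩ := by
      simp [PreDiagram.mul_def]
    rw [e] at hA
    have : multExt f (x :: w) = f x * multExt f w := by simp [multExt]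
    rw [this]
    have hx := h x
    generalize f x = z at hx
    induction hx using Submodule.span_induction with
    | mem y hy =>
      obtain ⟨C, hC, rfl⟩ := hy
      have := ih _ (hC A _ hA)
      rwa [map_mul, mul_assoc] at this
    | zero => simp
    | add y z _ _ hy hz => rw [add_mul, mul_add]; exact add_mem hy hz
    | smul c y _ hy => rw [smul_mul_assoc, mul_smul_comm]; exact Submodule.smul_mem _ _ hy

theorem base_mul (D : PreDiagram) : (⟨D.verts, [], D.ends⟩ * ⟨0, D.word, 0⟩ : PreDiagram) = D := by
  ext <;> simp [PreDiagram.mul_def]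

theorem deg_mul (A B : PreDiagram) : (A * B).deg = A.deg + B.deg := by
  simp [PreDiagram.deg, PreDiagram.mul_def]

theorem isDiagram_replace {κ κ' : Kind} {k k' : ℕ} {i i' : ℤ} {A B C C' : PreDiagram}
    (hκ : ∀ x, κ.Allows x → κ'.Allows x) (h : IsDiagram κ k i (A * C * B))
    (hn : C'.names = C.names) (ha : ∀ x ∈ C'.word, κ'.Allows x)
    (hk : C'.ends.card + k = C.ends.card + k') (hd : (C'.deg : ℤ) + i = C.deg + i') :
    IsDiagram κ' k' i' (A * C' * B) := by
  refine ⟨?_, ?_, ?_, ?_⟩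
  · intro x hx
    simp only [PreDiagram.mul_def, List.mem_append] at hx
    rcases hx with (hx | hx) | hx
    · exact hκ x (h.allows x (by simp [PreDiagram.mul_def, hx]))
    · exact ha x hx
    · exact hκ x (h.allows x (by simp [PreDiagram.mul_def, hx]))
  · have := h.card_ends
    simp only [PreDiagram.mul_def, Multiset.card_add] at this ⊢
    omega
  · have := h.deg_eq
    simp only [deg_mul] at this ⊢
    push_cast at this ⊢
    linarith
  · have := h.count_names
    simp only [names_mul] at this ⊢
    rwa [hn]

theorem dLin_mem {κ : Kind} {k : ℕ} {i j : ℤ} (hij : i + 1 = j) (D : PreDiagram)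
    (hD : IsDiagram κ k i D) : dLin (gen D) ∈ diagrams κ k j := by
  rw [dLin, linExt_gen]
  refine oddExt_mem _ (IsDiagram κ k i) dRule ?_ D.word _ (by rwa [base_mul])
  intro A B x h
  have hx : κ.Allows x := h.allows x (by simp [PreDiagram.mul_def])
  cases x with
  | leg1 l e =>
    rw [dRule, ent, ← map_mul, ← map_mul]
    refine gen_mem (isDiagram_replace (fun _ h => h) h rfl ?_ rfl ?_)
    · simpa using (by cases κ <;> exact hx : κ.Allows (.leg2 l e))
    · simp [PreDiagram.deg, Entry.deg]; omega
  | leg2 l e => simp [dRule]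
  | hollow =>
    rw [dRule, ent, ← map_mul, ← map_mul]
    refine gen_mem (isDiagram_replace (fun _ h => h) h rfl ?_ rfl ?_)
    · simpa using (by cases κ <;> exact hx : κ.Allows .filled)
    · simp [PreDiagram.deg, Entry.deg]; omega
  | filled => simp [dRule]

theorem iotaLin_mem {κ : Kind} {i j : ℤ} (hij : j + 1 = i) (D : PreDiagram)
    (hD : IsDiagram κ 0 i D) : iotaLin (gen D) ∈ diagrams κ 1 j := by
  rw [iotaLin, linExt_gen]
  have hinj : Function.Injective (fun n : ℕ => n + 2) := fun a b h => Nat.add_right_cancel h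
  refine oddExt_mem _ (fun D => IsDiagram κ 0 i D ∧ ∀ e ∈ D.names, 2 ≤ e) iotaRule ?_
    (D.relabel (· + 2)).word _ ?_
  · rintro A B x ⟨h, h2⟩
    have hx : κ.Allows x := h.allows x (by simp [PreDiagram.mul_def])
    cases x with
    | leg1 l e =>
      rw [iotaRule, iotaEnd, ← map_mul, ← map_mul]
      refine gen_mem (isDiagram_replace (fun _ h => h) h ?_ (by simp) rfl ?_)
      · simp [PreDiagram.names, Entry.names]
      · simp [PreDiagram.deg, Entry.deg]; omega
    | leg2 l e =>
      have hN : (A * (⟨{(e, 0, 1)}, [], 0⟩ * ⟨0, [], {0}⟩ * ⟨0, [.leg1 l 1], 0⟩) * B).names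
          = (A * ⟨0, [.leg2 l e], 0⟩ * B).names + ({0} + {0} + {1} + {1}) := by
        simp only [names_mul]
        simp only [PreDiagram.names, Entry.names, Multiset.map_singleton, Multiset.sum_singleton,
          Multiset.map_zero, Multiset.sum_zero, List.map_cons, List.map_nil, List.sum_cons,
          List.sum_nil, Multiset.insert_eq_cons, ← Multiset.singleton_add]
        abel
      rw [iotaRule, vert, iotaEnd, ent, ← map_mul, ← map_mul, ← map_mul, ← map_mul]
      refine gen_mem ⟨?_, ?_, ?_, ?_⟩
      · intro y hy
        simp only [PreDiagram.mul_def, List.mem_append, List.mem_singleton, List.not_mem_nil,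
          or_false, false_or] at hy
        rcases hy with (hy | rfl) | hy
        · exact h.allows y (by simp [PreDiagram.mul_def, hy])
        · cases κ <;> exact hx
        · exact h.allows y (by simp [PreDiagram.mul_def, hy])
      · have := h.card_ends
        simp only [PreDiagram.mul_def, Multiset.card_add, Multiset.card_zero,
          Multiset.card_singleton] at this ⊢
        omega
      · have := h.deg_eq
        simp only [deg_mul] at this ⊢
        simp [PreDiagram.deg, Entry.deg] at this ⊢
        omega
      · intro a ha
        rw [hN] at ha ⊢
        by_cases h0 : a ∈ (A * ⟨0, [.leg2 l e], 0⟩ * B).names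
        · have ha2 := h2 a h0
          rw [Multiset.count_add, h.count_names a h0]
          simp
          omega
        · rw [Multiset.count_add, Multiset.count_eq_zero_of_notMem h0]
          rw [Multiset.mem_add] at ha
          rcases ha with ha | ha
          · exact absurd ha h0
          · simp at ha
            rcases ha with rfl | rfl <;> simp
    | hollow => simp [iotaRule]
    | filled => simp [iotaRule]
  · rw [base_mul]
    refine ⟨(isDiagram_relabel _ hinj D).2 hD, ?_⟩
    intro e he
    rw [names_relabel] at he
    obtain ⟨a, _, rfl⟩ := Multiset.mem_map.1 he
    omega

theorem isDiagram_mono {κ κ' : Kind} (hκ : ∀ x, κ.Allows x → κ'.Allows x) {k : ℕ} {i : ℤ}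
    {D : PreDiagram} (h : IsDiagram κ k i D) : IsDiagram κ' k i D :=
  ⟨fun x hx => hκ x (h.allows x hx), h.card_ends, h.deg_eq, h.count_names⟩

theorem allows_W_T (x : Entry) (h : Kind.W.Allows x) : Kind.T.Allows x := by
  cases x <;> simp_all [Kind.Allows, Entry.OnNC, Entry.isLeg]

theorem id_mem {k : ℕ} {i : ℤ} (D : PreDiagram) (hD : IsDiagram .W k i D) :
    (LinearMap.id : Comb →ₗ[ℚ] Comb) (gen D) ∈ diagrams .T k i :=
  gen_mem (isDiagram_mono allows_W_T hD)

theorem commLin_mem {k : ℕ} {i : ℤ} (D : PreDiagram) (hD : IsDiagram .W k i D) :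
    commLin (gen D) ∈ diagrams .T k i := by
  rw [commLin, linExt_gen]
  refine multExt_mem _ (IsDiagram .T k i) (fun _ => gen_mem) commRule ?_ D.word _
    (by rw [base_mul]; exact isDiagram_mono allows_W_T hD)
  intro x
  cases x with
  | leg1 l e =>
    refine Submodule.subset_span ⟨_, fun A B h => ?_, rfl⟩
    exact isDiagram_replace (fun _ h => h) h rfl (by simp [Kind.Allows, Entry.isLeg]) rfl rfl
  | leg2 l e =>
    refine Submodule.subset_span ⟨_, fun A B h => ?_, rfl⟩
    exact isDiagram_replace (fun _ h => h) h rfl (by simp [Kind.Allows, Entry.isLeg]) rfl rfl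
  | hollow => exact Submodule.subset_span ⟨_, fun A B h => h, rfl⟩
  | filled => exact Submodule.subset_span ⟨_, fun A B h => h, rfl⟩

theorem thetaLin_mem {k : ℕ} {i : ℤ} (D : PreDiagram) (hD : IsDiagram .W k i D) :
    thetaLin (gen D) ∈ diagrams .TdR k i := by
  rw [thetaLin, linExt_gen]
  refine multExt_mem _ (IsDiagram .TdR k i) (fun _ => gen_mem) thetaRule ?_ D.word _
    (by rw [base_mul]; exact isDiagram_mono (κ' := .TdR) (fun _ _ => trivial) hD)
  have one : ∀ x y : Entry, y.names = x.names → y.deg = x.deg →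
      ent y ∈ Submodule.span ℚ
        (gen '' {C | ∀ A B, IsDiagram .TdR k i (A * ⟨0, [x], 0⟩ * B) →
          IsDiagram .TdR k i (A * C * B)}) := by
    intro x y hn hd
    refine Submodule.subset_span ⟨_, fun A B h => ?_, rfl⟩
    refine isDiagram_replace (fun _ h => h) h ?_ (fun _ _ => trivial) rfl ?_
    · simp [PreDiagram.names, hn]
    · simp [PreDiagram.deg, hd]
  have two : ∀ x y z : Entry, y.names + z.names = x.names → y.deg + z.deg = x.deg →
      ent y * ent z ∈ Submodule.span ℚ
        (gen '' {C | ∀ A B, IsDiagram .TdR k i (A * ⟨0, [x], 0⟩ * B) →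
          IsDiagram .TdR k i (A * C * B)}) := by
    intro x y z hn hd
    rw [ent, ent, ← map_mul]
    refine Submodule.subset_span ⟨_, fun A B h => ?_, rfl⟩
    refine isDiagram_replace (fun _ h => h) h ?_ (fun _ _ => trivial) rfl ?_
    · rw [names_mul]
      simpa [PreDiagram.names] using hn
    · simp [PreDiagram.mul_def, PreDiagram.deg, ← hd]
  intro x
  rcases x with ⟨_ | _, e⟩ | ⟨_ | _, e⟩ | _ | _
  · exact sub_mem (add_mem (two _ _ _ rfl rfl) (one _ _ rfl rfl)) (two _ _ _ rfl rfl)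
  · exact one _ _ rfl rfl
  · exact add_mem (sub_mem (add_mem (sub_mem (two _ _ _ rfl rfl) (two _ _ _ rfl rfl))
      (one _ _ rfl rfl)) (two _ _ _ rfl rfl)) (two _ _ _ rfl rfl)
  · exact one _ _ rfl rfl
  · exact one _ _ rfl rfl
  · exact one _ _ rfl rfl

theorem intLin_mem {k : ℕ} {i j : ℤ} (hij : j + 1 = i) (D : PreDiagram)
    (hD : IsDiagram .TdR k i D) : intLin (gen D) ∈ diagrams .T k j := by
  rw [intLin, linExt_gen, wordOp, intWord, mul_smul_comm, ← map_mul]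
  by_cases hc : D.word.count Entry.filled = 1
  · refine Submodule.smul_mem _ _ (gen_mem ⟨?_, ?_, ?_, ?_⟩)
    · intro x hx
      simp only [PreDiagram.mul_def, List.nil_append, List.mem_filter] at hx
      exact hx.2
    · simpa [PreDiagram.mul_def] using hD.card_ends
    · have h1 : ∀ w : List Entry, ((w.filter Entry.isLeg).map Entry.deg).sum
          + w.count Entry.filled = (w.map Entry.deg).sum := by
        intro w
        induction w with
        | nil => rfl
        | cons x w ih =>
          cases x <;> simp_all [List.filter_cons, Entry.isLeg, Entry.deg] <;> omega
      have h2 := hD.deg_eq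
      have h3 := h1 D.word
      simp only [PreDiagram.deg, PreDiagram.mul_def, List.nil_append] at h2 ⊢
      omega
    · have h1 : ∀ w : List Entry, ((w.filter Entry.isLeg).map Entry.names).sum
          = (w.map Entry.names).sum := by
        intro w
        induction w with
        | nil => rfl
        | cons x w ih =>
          cases x <;> simp_all [List.filter_cons, Entry.isLeg, Entry.names]
      have h2 := hD.count_names
      have h3 : (⟨D.verts, [], D.ends⟩ * ⟨0, D.word.filter Entry.isLeg, 0⟩ : PreDiagram).names
          = D.names := by
        simp [PreDiagram.names, PreDiagram.mul_def, h1]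
      rwa [h3]
  · simp [intCoeff, hc]

/-! ### `ι`-complexes, their maps and homotopies -/

/-- The data of an `ι`-complex over `ℚ`: two sequences of vector spaces with maps `d` and `dIota` of
grade `1`, and a map `iota` of grade `-1` from the first to the second. The maps are indexed by
source and target degree. The laws are stated in `IsIotaComplex`. -/
structure IotaSystem where
  K : ℤ → Type
  KIota : ℤ → Type
  [addK : ∀ i, AddCommGroup (K i)]
  [addKIota : ∀ i, AddCommGroup (KIota i)]
  [modK : ∀ i, Module ℚ (K i)]
  [modKIota : ∀ i, Module ℚ (KIota i)]
  d : ∀ i j, i + 1 = j → (K i →ₗ[ℚ] K j)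
  dIota : ∀ i j, i + 1 = j → (KIota i →ₗ[ℚ] KIota j)
  iota : ∀ i j, j + 1 = i → (K i →ₗ[ℚ] KIota j)

attribute [instance] IotaSystem.addK IotaSystem.addKIota IotaSystem.modK IotaSystem.modKIota

/-- Both rows are complexes and `ι ∘ d = - d_ι ∘ ι`. -/
structure IotaSystem.IsIotaComplex (X : IotaSystem) : Prop where
  d_comp_d : ∀ i j k (hij : i + 1 = j) (hjk : j + 1 = k), X.d j k hjk ∘ₗ X.d i j hij = 0
  dIota_comp_dIota : ∀ i j k (hij : i + 1 = j) (hjk : j + 1 = k),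
    X.dIota j k hjk ∘ₗ X.dIota i j hij = 0
  iota_comp_d : ∀ i j k (hij : i + 1 = j) (hki : k + 1 = i),
    X.iota j i hij ∘ₗ X.d i j hij = -(X.dIota k i hki ∘ₗ X.iota i k hki)

/-- A pair of sequences of linear maps of grade `0`. -/
structure IotaSystem.Maps (X Y : IotaSystem) where
  f : ∀ i, X.K i →ₗ[ℚ] Y.K i
  fIota : ∀ i, X.KIota i →ₗ[ℚ] Y.KIota i

/-- A map of `ι`-complexes: it commutes with the differentials and with `ι`. -/
structure IotaSystem.Maps.IsIotaMap {X Y : IotaSystem} (F : X.Maps Y) : Prop where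
  comm_d : ∀ i j (h : i + 1 = j), F.f j ∘ₗ X.d i j h = Y.d i j h ∘ₗ F.f i
  comm_dIota : ∀ i j (h : i + 1 = j), F.fIota j ∘ₗ X.dIota i j h = Y.dIota i j h ∘ₗ F.fIota i
  comm_iota : ∀ i j (h : j + 1 = i), F.fIota j ∘ₗ X.iota i j h = Y.iota i j h ∘ₗ F.f i

/-- A pair of sequences of linear maps of grade `-1`. -/
structure IotaSystem.LoweringMaps (X Y : IotaSystem) where
  s : ∀ i j, j + 1 = i → (X.K i →ₗ[ℚ] Y.K j)
  sIota : ∀ i j, j + 1 = i → (X.KIota i →ₗ[ℚ] Y.KIota j)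

/-- `S` is an `ι`-chain homotopy between `F` and `G`: `d s + s d = f - g`, the same for the second
row, and `s_ι ι + ι s = 0`. -/
structure IotaSystem.LoweringMaps.IsIotaChainHomotopy {X Y : IotaSystem} (S : X.LoweringMaps Y)
    (F G : X.Maps Y) : Prop where
  homotopy : ∀ i j k (hij : j + 1 = i) (hik : i + 1 = k),
    Y.d j i hij ∘ₗ S.s i j hij + S.s k i hik ∘ₗ X.d i k hik = F.f i - G.f i
  homotopyIota : ∀ i j k (hij : j + 1 = i) (hik : i + 1 = k),
    Y.dIota j i hij ∘ₗ S.sIota i j hij + S.sIota k i hik ∘ₗ X.dIota i k hik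
      = F.fIota i - G.fIota i
  comm_iota : ∀ i j k (hij : j + 1 = i) (hjk : k + 1 = j),
    S.sIota j k hjk ∘ₗ X.iota i j hij + Y.iota j k hjk ∘ₗ S.s i j hij = 0

/-- The system of diagrams of type `κ`: the spaces of diagrams of grade `i` without, respectively with
exactly one, special vertex, with the maps `d` and `ι`. For `κ = W`, `T`, `TdR` these are the systems
`W̃`, `T` and `T_dR`. -/
def system (κ : Kind) : IotaSystem where
  K := Space κ 0
  KIota := Space κ 1
  d _ _ h := induced dLin (dLin_mem h) dLin_rel
  dIota _ _ h := induced dLin (dLin_mem h) dLin_rel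
  iota _ _ h := induced iotaLin (iotaLin_mem h) iotaLin_rel

/-- The map `i_n`, which puts all legs on the non-commutative line of a `T`-diagram. -/
def iN : (system .W).Maps (system .T) where
  f _ := induced LinearMap.id id_mem id_rel
  fIota _ := induced LinearMap.id id_mem id_rel

/-- The map `i_c`, which puts all legs on the commutative line of a `T`-diagram. -/
def iC : (system .W).Maps (system .T) where
  f _ := induced commLin commLin_mem commLin_rel
  fIota _ := induced commLin commLin_mem commLin_rel

/-- The map `θ`. -/
def theta : (system .W).Maps (system .TdR) where
  f _ := induced thetaLin thetaLin_mem thetaLin_rel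
  fIota _ := induced thetaLin thetaLin_mem thetaLin_rel

/-- The formal integral along the third line. -/
def integral : (system .TdR).LoweringMaps (system .T) where
  s _ _ h := induced intLin (intLin_mem h) intLin_rel
  sIota _ _ h := induced intLin (intLin_mem h) intLin_rel

/-- The composition of `θ` with the formal integral. -/
def sT : (system .W).LoweringMaps (system .T) where
  s i j h := integral.s i j h ∘ₗ theta.f i
  sIota i j h := integral.sIota i j h ∘ₗ theta.fIota i

end WeilDiag
end

/-!
Up to a renaming of edges, every operator of the theorem works by substitutions in the sequence of
legs and discs, and is determined by its effect on leg-free diagrams together with a rule for adding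
one entry on the left
(`oddExt_ent_mul`, `multExt_ent_mul`). With a single exception, the identities to be proved therefore
hold already for formal combinations of diagrams, before passing to the relations, and they are
checked one entry at a time.

The homotopy formula is Stokes' formula on the unit interval. The third line encodes the polynomial
forms in one variable, `t` being a hollow and `dt` a filled disc, and the values
`∫ tᵐ dt = 1 / (m + 1)` can be replaced by those of an arbitrary functional `P` on polynomials. An
induction along the line, in which passing a hollow disc shifts `P`, shows that the boundary of this
generalized integral is evaluation against `f ↦ P (f')` (`integralWord_stokes`). For the actual
integral that is evaluation at `t = 1` minus evaluation at `t = 0`. As `θ` commutes with `d` and `ι`,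
and becomes the identity at `t = 1` and the map to the commutative line at `t = 0`, the homotopy
formula follows. The integral anticommutes with `ι` (`integralWord_iotaRaw`) because moving the
filled disc past a leg yields a sign that depends on the parity of the grade of the leg, which `ι`
changes.

The exception is `ι ∘ d + d ∘ ι = 0`, for diagrams without special vertex. The left hand side is
the sum of all ways to attach an edge, ending in the special vertex, at a leg. To see that it
vanishes, attach such an edge at all edge ends of the diagram, those at the trivalent vertices
included. The three edge ends at a trivalent vertex contribute zero by IHX (`attachSum_vert`), while
the two ends of any edge contribute opposite terms by AS (`attach_add_attach_mem`); as there is no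
special vertex, what remains are the terms for the legs. To speak of the single ends of edges, a
diagram is written as `S.relabel f`, where all edge ends of `S` have different names and `f`
identifies the two ends of each edge.
-/

noncomputable section

namespace WeilDiag

/-! ### Operators determined by their effect on the entries -/

/-- The part of a diagram without legs and discs: trivalent and special vertices. -/
def base (v : Multiset (ℕ × ℕ × ℕ)) (n : Multiset ℕ) : Comb := gen ⟨v, [], n⟩

theorem base_comm (v : Multiset (ℕ × ℕ × ℕ)) (n : Multiset ℕ) (z : Comb) :
    z * base v n = base v n * z := by
  induction z using Comb.induction with
  | _h0 => simp
  | hg D =>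
    simp only [base, ← map_mul, PreDiagram.mul_def, List.append_nil, List.nil_append]
    rw [add_comm v, add_comm n]
  | ha x y hx hy => rw [add_mul, mul_add, hx, hy]
  | hs c x hx => rw [smul_mul_assoc, mul_smul_comm, hx]

theorem gen_cons (x : Entry) (v : Multiset (ℕ × ℕ × ℕ)) (w : List Entry) (n : Multiset ℕ) :
    gen ⟨v, x :: w, n⟩ = ent x * gen ⟨v, w, n⟩ := by
  simp [ent, ← map_mul, PreDiagram.mul_def]

/-- Combinations of diagrams are generated linearly from the leg-free ones by adding entries on the
left. -/
theorem Comb.induction_entries {p : Comb → Prop} (x : Comb) (hz : p 0) (hb : ∀ v n, p (base v n))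
    (he : ∀ x z, p z → p (ent x * z))
    (ha : ∀ x y, p x → p y → p (x + y)) (hs : ∀ (c : ℚ) x, p x → p (c • x)) : p x := by
  induction x using Comb.induction with
  | _h0 => exact hz
  | hg D =>
    obtain ⟨v, w, n⟩ := D
    induction w with
    | nil => exact hb v n
    | cons x w ih => rw [gen_cons]; exact he _ _ ih
  | ha x y hx hy => exact ha _ _ hx hy
  | hs c x hx => exact hs _ _ hx

/-- Two linear operators agree if they agree on the leg-free diagrams and if their agreement is
preserved by adding an entry on the left. -/
theorem linearMap_ext_entries {F G : Comb →ₗ[ℚ] Comb} (hb : ∀ v n, F (base v n) = G (base v n))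
    (he : ∀ x z, F z = G z → F (ent x * z) = G (ent x * z)) (z : Comb) : F z = G z := by
  induction z using Comb.induction_entries with
  | hz => simp
  | hb v n => exact hb v n
  | he x z h => exact he x z h
  | ha x y hx hy => rw [map_add, map_add, hx, hy]
  | hs c x hx => rw [map_smul, map_smul, hx]

/-- The operator on diagrams given by an operation on sequences of entries. -/
def wordLin (E : List Entry → Comb) : Comb →ₗ[ℚ] Comb := linExt (wordOp E)

theorem wordLin_base (E : List Entry → Comb) (v : Multiset (ℕ × ℕ × ℕ)) (n : Multiset ℕ) :
    wordLin E (base v n) = base v n * E [] := by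
  rw [wordLin, base, linExt_gen]; rfl

theorem wordLin_base_mul (E : List Entry → Comb) (v : Multiset (ℕ × ℕ × ℕ)) (n : Multiset ℕ)
    (z : Comb) : wordLin E (base v n * z) = base v n * wordLin E z := by
  induction z using Comb.induction with
  | _h0 => simp
  | hg D =>
    rw [wordLin, base, ← map_mul, linExt_gen, linExt_gen, wordOp, wordOp, ← mul_assoc, ← map_mul]
    simp [PreDiagram.mul_def]
  | ha x y hx hy => rw [mul_add, map_add, map_add, mul_add, hx, hy]
  | hs c x hx => rw [mul_smul_comm, map_smul, map_smul, mul_smul_comm, hx]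

theorem wordLin_vert_mul (E : List Entry → Comb) (a b c : ℕ) (z : Comb) :
    wordLin E (vert a b c * z) = vert a b c * wordLin E z := wordLin_base_mul E _ _ z

theorem wordLin_iotaEnd_mul (E : List Entry → Comb) (e : ℕ) (z : Comb) :
    wordLin E (iotaEnd e * z) = iotaEnd e * wordLin E z := wordLin_base_mul E _ _ z

/-- If `E (x :: w)` depends linearly on the diagram with entries `w` and on `E' w`, then so does the
operator on diagrams. -/
theorem wordLin_ent_mul {E E' : List Entry → Comb} {x : Entry} {a b : Comb}
    (h : ∀ w, E (x :: w) = a * gen ⟨0, w, 0⟩ + b * E' w) (z : Comb) :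
    wordLin E (ent x * z) = a * z + b * wordLin E' z := by
  induction z using Comb.induction with
  | _h0 => simp
  | hg D =>
    have e1 : gen D = base D.verts D.ends * gen ⟨0, D.word, 0⟩ := by
      rw [base, ← map_mul, base_mul]
    have e2 : (⟨D.verts, [], D.ends⟩ * ⟨0, D.word, 0⟩ : PreDiagram) = D := base_mul D
    rw [e1, ← mul_assoc, base_comm, mul_assoc, wordLin_base_mul, wordLin_base_mul, ← mul_assoc,
      ← mul_assoc b, base_comm, base_comm, mul_assoc, mul_assoc, ← mul_add, ent_mul_gen, wordLin,
      wordLin, linExt_gen, linExt_gen, wordOp, wordOp, h]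
    congr 1
    have : gen ⟨0, [], 0⟩ = 1 := map_one gen
    simp only [this, one_mul]
  | ha x y hx hy => simp only [mul_add, map_add, hx, hy]; abel
  | hs c x hx => simp only [mul_smul_comm, map_smul, hx, smul_add]

theorem wordLin_relabel {E : List Entry → Comb} {f : ℕ → ℕ}
    (h : ∀ w, E (w.map (Entry.relabel f)) = relabelAlg f (E w)) (z : Comb) :
    wordLin E (relabelAlg f z) = relabelAlg f (wordLin E z) := by
  induction z using Comb.induction with
  | _h0 => simp
  | hg D => rw [relabelAlg_gen, wordLin, linExt_gen, linExt_gen, wordOp_relabel E f D (h _)]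
  | ha x y hx hy => rw [map_add, map_add, map_add, map_add, hx, hy]
  | hs c x hx => rw [map_smul, map_smul, map_smul, map_smul, hx]

theorem oddExt_base (r : Entry → Comb) (v : Multiset (ℕ × ℕ × ℕ)) (n : Multiset ℕ) :
    wordLin (oddExt r) (base v n) = 0 := by
  rw [wordLin_base, oddExt, mul_zero]

/-- The Leibniz rule for operators of odd grade. -/
theorem oddExt_ent_mul (r : Entry → Comb) (x : Entry) (z : Comb) :
    wordLin (oddExt r) (ent x * z) = r x * z + x.sgn • (ent x * wordLin (oddExt r) z) := by
  rw [← smul_mul_assoc]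
  exact wordLin_ent_mul (fun w => by rw [oddExt, smul_mul_assoc]) z

theorem multExt_base (r : Entry → Comb) (v : Multiset (ℕ × ℕ × ℕ)) (n : Multiset ℕ) :
    wordLin (multExt r) (base v n) = base v n := by
  rw [wordLin_base, multExt, List.map_nil, List.prod_nil, mul_one]

theorem multExt_ent_mul (r : Entry → Comb) (x : Entry) (z : Comb) :
    wordLin (multExt r) (ent x * z) = r x * wordLin (multExt r) z := by
  have := wordLin_ent_mul (E := multExt r) (E' := multExt r) (x := x) (a := 0) (b := r x)
    (fun w => by simp [multExt]) z
  simpa using this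

theorem dLin_eq : dLin = wordLin (oddExt dRule) := rfl
theorem commLin_eq : commLin = wordLin (multExt commRule) := rfl
theorem thetaLin_eq : thetaLin = wordLin (multExt thetaRule) := rfl

/-- The operator `ι` without the preliminary renaming of the edges. -/
def iotaRaw : Comb →ₗ[ℚ] Comb := wordLin (oddExt iotaRule)

theorem iotaLin_eq (z : Comb) : iotaLin z = iotaRaw (relabelAlg (· + 2) z) := by
  induction z using Comb.induction with
  | _h0 => simp
  | ha x y hx hy => simp only [map_add, hx, hy]
  | hs c x hx => simp only [map_smul, hx]
  | hg D => rw [iotaLin, linExt_gen, relabelAlg_gen, iotaRaw, wordLin, linExt_gen]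

/-! ### Identities between the operators -/

theorem vert_comm (a b c : ℕ) (z : Comb) : z * vert a b c = vert a b c * z := base_comm _ _ z

theorem iotaEnd_comm (e : ℕ) (z : Comb) : z * iotaEnd e = iotaEnd e * z := base_comm _ _ z

theorem vert_left_comm (a b c : ℕ) (x z : Comb) :
    x * (vert a b c * z) = vert a b c * (x * z) := by
  rw [← mul_assoc, vert_comm, mul_assoc]

theorem dLin_dLin (z : Comb) : dLin (dLin z) = 0 := by
  rw [dLin_eq]
  refine linearMap_ext_entries (F := wordLin (oddExt dRule) ∘ₗ wordLin (oddExt dRule)) (G := 0)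
    (fun v n => ?_) (fun x z h => ?_) z
  · simp [oddExt_base]
  · simp only [LinearMap.comp_apply, LinearMap.zero_apply] at h ⊢
    cases x <;>
      simp [oddExt_ent_mul, dRule, h, Entry.sgn, Entry.deg]

theorem commLin_dLin (z : Comb) : commLin (dLin z) = dLin (commLin z) := by
  rw [dLin_eq, commLin_eq]
  refine linearMap_ext_entries (F := wordLin (multExt commRule) ∘ₗ wordLin (oddExt dRule))
    (G := wordLin (oddExt dRule) ∘ₗ wordLin (multExt commRule)) (fun v n => ?_)
    (fun x z h => ?_) z
  · simp [oddExt_base, multExt_base]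
  · simp only [LinearMap.comp_apply] at h ⊢
    cases x <;>
      simp [oddExt_ent_mul, multExt_ent_mul, dRule, commRule, h, Entry.sgn, Entry.deg]

theorem commLin_iotaRaw (z : Comb) : commLin (iotaRaw z) = iotaRaw (commLin z) := by
  rw [iotaRaw, commLin_eq]
  refine linearMap_ext_entries (F := wordLin (multExt commRule) ∘ₗ wordLin (oddExt iotaRule))
    (G := wordLin (oddExt iotaRule) ∘ₗ wordLin (multExt commRule)) (fun v n => ?_)
    (fun x z h => ?_) z
  · simp [oddExt_base, multExt_base]
  · simp only [LinearMap.comp_apply] at h ⊢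
    cases x <;>
      simp [oddExt_ent_mul, multExt_ent_mul, iotaRule, commRule, h, Entry.sgn, Entry.deg,
        mul_assoc, wordLin_vert_mul, wordLin_iotaEnd_mul]

theorem thetaLin_dLin (z : Comb) : thetaLin (dLin z) = dLin (thetaLin z) := by
  rw [dLin_eq, thetaLin_eq]
  refine linearMap_ext_entries (F := wordLin (multExt thetaRule) ∘ₗ wordLin (oddExt dRule))
    (G := wordLin (oddExt dRule) ∘ₗ wordLin (multExt thetaRule)) (fun v n => ?_)
    (fun x z h => ?_) z
  · simp [oddExt_base, multExt_base]
  · simp only [LinearMap.comp_apply] at h ⊢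
    rcases x with ⟨_ | _, e⟩ | ⟨_ | _, e⟩ | _ | _ <;>
      simp [oddExt_ent_mul, multExt_ent_mul, dRule, thetaRule, h, Entry.sgn, Entry.deg,
        mul_assoc, add_mul, sub_mul, mul_add] <;> abel

theorem thetaLin_iotaRaw (z : Comb) : thetaLin (iotaRaw z) = iotaRaw (thetaLin z) := by
  rw [iotaRaw, thetaLin_eq]
  refine linearMap_ext_entries (F := wordLin (multExt thetaRule) ∘ₗ wordLin (oddExt iotaRule))
    (G := wordLin (oddExt iotaRule) ∘ₗ wordLin (multExt thetaRule)) (fun v n => ?_)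
    (fun x z h => ?_) z
  · simp [oddExt_base, multExt_base]
  · simp only [LinearMap.comp_apply] at h ⊢
    rcases x with ⟨_ | _, e⟩ | ⟨_ | _, e⟩ | _ | _ <;>
      simp [oddExt_ent_mul, multExt_ent_mul, iotaRule, thetaRule, h, Entry.sgn, Entry.deg,
        mul_assoc, add_mul, sub_mul, mul_add, mul_sub, wordLin_vert_mul, wordLin_iotaEnd_mul] <;>
      abel

theorem dLin_relabelAlg (f : ℕ → ℕ) (z : Comb) :
    dLin (relabelAlg f z) = relabelAlg f (dLin z) :=
  wordLin_relabel (fun w => oddExt_relabel _ f w fun x _ => dRule_relabel f x) z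

theorem commLin_relabelAlg (f : ℕ → ℕ) (z : Comb) :
    commLin (relabelAlg f z) = relabelAlg f (commLin z) :=
  wordLin_relabel (fun w => multExt_relabel _ f w (commRule_relabel f)) z

theorem thetaLin_relabelAlg (f : ℕ → ℕ) (z : Comb) :
    thetaLin (relabelAlg f z) = relabelAlg f (thetaLin z) :=
  wordLin_relabel (fun w => multExt_relabel _ f w (thetaRule_relabel f)) z

theorem intLin_relabelAlg (f : ℕ → ℕ) (z : Comb) :
    intLin (relabelAlg f z) = relabelAlg f (intLin z) :=
  wordLin_relabel (entry_map_intWord f) z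

/-! ### The formal integral and Stokes' formula -/

/-- Evaluation of the third line against a functional on polynomials in one variable, given by its
values `P m` on the powers `tᵐ`: filled discs are sent to zero, and `m` hollow discs are removed at
the cost of the factor `P m`. -/
def evalWord : (ℕ → ℚ) → List Entry → Comb
  | P, [] => P 0 • 1
  | P, .leg1 l e :: w => ent (.leg1 l e) * evalWord P w
  | P, .leg2 l e :: w => ent (.leg2 l e) * evalWord P w
  | P, .hollow :: w => evalWord (fun m => P (m + 1)) w
  | _, .filled :: _ => 0

/-- The formal integral with the values `P m` in place of `∫ tᵐ dt = 1 / (m + 1)`. -/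
def integralWord : (ℕ → ℚ) → List Entry → Comb
  | _, [] => 0
  | P, .leg1 l e :: w => -(ent (.leg1 l e) * integralWord P w)
  | P, .leg2 l e :: w => ent (.leg2 l e) * integralWord P w
  | P, .hollow :: w => integralWord (fun m => P (m + 1)) w
  | P, .filled :: w => evalWord P w

theorem evalWord_eq (P : ℕ → ℚ) (w : List Entry) :
    evalWord P w = (if w.count Entry.filled = 0 then P (w.count Entry.hollow) else 0)
      • gen ⟨0, w.filter Entry.isLeg, 0⟩ := by
  induction w generalizing P with
  | nil =>
    have : gen ⟨0, [], 0⟩ = 1 := map_one gen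
    simp [evalWord, this]
  | cons x w ih =>
    cases x <;>
      simp [evalWord, ih, Entry.isLeg, ent_mul_gen, List.filter_cons]

theorem integralWord_eq (P : ℕ → ℚ) (w : List Entry) :
    integralWord P w
      = (if w.count Entry.filled = 1 then signBefore w * P (w.count Entry.hollow) else 0)
        • gen ⟨0, w.filter Entry.isLeg, 0⟩ := by
  induction w generalizing P with
  | nil => simp [integralWord]
  | cons x w ih =>
    cases x <;>
      simp [integralWord, evalWord_eq, ih, Entry.isLeg, signBefore, Entry.sgn, Entry.deg,
        ent_mul_gen, List.filter_cons]
    split_ifs <;> simp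

theorem intLin_eq : intLin = wordLin (integralWord fun m => 1 / ((m : ℚ) + 1)) := by
  have : intWord = integralWord fun m => 1 / ((m : ℚ) + 1) := by
    funext w
    rw [integralWord_eq, intWord, intCoeff, mul_one_div]
  rw [intLin, this, wordLin]

section Rules

variable (P : ℕ → ℚ) (z : Comb)

theorem evalWord_base (v : Multiset (ℕ × ℕ × ℕ)) (n : Multiset ℕ) :
    wordLin (evalWord P) (base v n) = P 0 • base v n := by
  rw [wordLin_base, evalWord, mul_smul_comm, mul_one]

theorem integralWord_base (v : Multiset (ℕ × ℕ × ℕ)) (n : Multiset ℕ) :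
    wordLin (integralWord P) (base v n) = 0 := by
  rw [wordLin_base, integralWord, mul_zero]

theorem evalWord_leg1 (l : Line) (e : ℕ) : wordLin (evalWord P) (ent (.leg1 l e) * z)
    = ent (.leg1 l e) * wordLin (evalWord P) z := by
  simpa using wordLin_ent_mul (E := evalWord P) (E' := evalWord P) (x := .leg1 l e) (a := 0)
    (b := ent (.leg1 l e)) (fun w => by simp [evalWord]) z

theorem evalWord_leg2 (l : Line) (e : ℕ) : wordLin (evalWord P) (ent (.leg2 l e) * z)
    = ent (.leg2 l e) * wordLin (evalWord P) z := by
  simpa using wordLin_ent_mul (E := evalWord P) (E' := evalWord P) (x := .leg2 l e) (a := 0)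
    (b := ent (.leg2 l e)) (fun w => by simp [evalWord]) z

theorem evalWord_hollow : wordLin (evalWord P) (ent .hollow * z)
    = wordLin (evalWord fun m => P (m + 1)) z := by
  simpa using wordLin_ent_mul (E := evalWord P) (E' := evalWord fun m => P (m + 1))
    (x := .hollow) (a := 0) (b := 1) (fun w => by simp [evalWord]) z

theorem evalWord_filled : wordLin (evalWord P) (ent .filled * z) = 0 := by
  simpa using wordLin_ent_mul (E := evalWord P) (E' := evalWord P)
    (x := .filled) (a := 0) (b := 0) (fun w => by simp [evalWord]) z

theorem integralWord_leg1 (l : Line) (e : ℕ) : wordLin (integralWord P) (ent (.leg1 l e) * z)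
    = -(ent (.leg1 l e) * wordLin (integralWord P) z) := by
  simpa using wordLin_ent_mul (E := integralWord P) (E' := integralWord P) (x := .leg1 l e)
    (a := 0) (b := -ent (.leg1 l e)) (fun w => by simp [integralWord]) z

theorem integralWord_leg2 (l : Line) (e : ℕ) : wordLin (integralWord P) (ent (.leg2 l e) * z)
    = ent (.leg2 l e) * wordLin (integralWord P) z := by
  simpa using wordLin_ent_mul (E := integralWord P) (E' := integralWord P) (x := .leg2 l e)
    (a := 0) (b := ent (.leg2 l e)) (fun w => by simp [integralWord]) z

theorem integralWord_hollow : wordLin (integralWord P) (ent .hollow * z)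
    = wordLin (integralWord fun m => P (m + 1)) z := by
  simpa using wordLin_ent_mul (E := integralWord P) (E' := integralWord fun m => P (m + 1))
    (x := .hollow) (a := 0) (b := 1) (fun w => by simp [integralWord]) z

theorem integralWord_filled : wordLin (integralWord P) (ent .filled * z)
    = wordLin (evalWord P) z := by
  simpa using wordLin_ent_mul (E := integralWord P) (E' := evalWord P)
    (x := .filled) (a := 0) (b := 1) (fun w => by simp [integralWord]) z

end Rules

/-- Two families of linear operators agree if they agree on the leg-free diagrams and if their
agreement is preserved by adding an entry on the left. The agreement is assumed for all parameters
`P` at a time, so that `P` may be shifted when a hollow disc is passed. -/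
theorem linearMap_family_ext_entries {F G : (ℕ → ℚ) → Comb →ₗ[ℚ] Comb}
    (hb : ∀ P v n, F P (base v n) = G P (base v n))
    (he : ∀ x z, (∀ P, F P z = G P z) → ∀ P, F P (ent x * z) = G P (ent x * z))
    (P : ℕ → ℚ) (z : Comb) : F P z = G P z := by
  revert P
  induction z using Comb.induction_entries with
  | hz => simp
  | hb v n => exact fun P => hb P v n
  | he x z h => exact he x z h
  | ha x y hx hy => intro P; rw [map_add, map_add, hx, hy]
  | hs c x hx => intro P; rw [map_smul, map_smul, hx]

theorem evalWord_dLin (P : ℕ → ℚ) (z : Comb) :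
    wordLin (evalWord P) (dLin z) = dLin (wordLin (evalWord P) z) := by
  rw [dLin_eq]
  refine linearMap_family_ext_entries (F := fun P => wordLin (evalWord P) ∘ₗ wordLin (oddExt dRule))
    (G := fun P => wordLin (oddExt dRule) ∘ₗ wordLin (evalWord P)) (fun P v n => ?_)
    (fun x z h P => ?_) P z
  · simp [oddExt_base, evalWord_base]
  · simp only [LinearMap.comp_apply] at h ⊢
    cases x <;>
      simp [oddExt_ent_mul, evalWord_leg1, evalWord_leg2, evalWord_hollow, evalWord_filled, dRule,
        h, Entry.sgn, Entry.deg]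

theorem evalWord_iotaRaw (P : ℕ → ℚ) (z : Comb) :
    wordLin (evalWord P) (iotaRaw z) = iotaRaw (wordLin (evalWord P) z) := by
  rw [iotaRaw]
  refine linearMap_family_ext_entries
    (F := fun P => wordLin (evalWord P) ∘ₗ wordLin (oddExt iotaRule))
    (G := fun P => wordLin (oddExt iotaRule) ∘ₗ wordLin (evalWord P)) (fun P v n => ?_)
    (fun x z h P => ?_) P z
  · simp [oddExt_base, evalWord_base]
  · simp only [LinearMap.comp_apply] at h ⊢
    cases x <;>
      simp [oddExt_ent_mul, evalWord_leg1, evalWord_leg2, evalWord_hollow, evalWord_filled,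
        iotaRule, h, Entry.sgn, Entry.deg, wordLin_vert_mul, wordLin_iotaEnd_mul, mul_assoc]

theorem evalWord_sub (P Q : ℕ → ℚ) (z : Comb) :
    wordLin (evalWord fun m => P m - Q m) z
      = wordLin (evalWord P) z - wordLin (evalWord Q) z := by
  have : ∀ w : List Entry, evalWord (fun m => P m - Q m) w = evalWord P w - evalWord Q w := by
    intro w
    rw [evalWord_eq, evalWord_eq, evalWord_eq, ← sub_smul]
    split_ifs <;> simp
  induction z using Comb.induction with
  | _h0 => simp
  | hg D => simp only [wordLin, linExt_gen, wordOp, this, mul_sub]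
  | ha x y hx hy => simp only [map_add, hx, hy]; abel
  | hs c x hx => simp only [map_smul, hx, smul_sub]

theorem evalWord_add (P Q : ℕ → ℚ) (z : Comb) :
    wordLin (evalWord fun m => P m + Q m) z
      = wordLin (evalWord P) z + wordLin (evalWord Q) z := by
  simpa [eq_sub_iff_add_eq, eq_comm] using evalWord_sub (fun m => P m + Q m) Q z

/-- Stokes' formula on the third line, for an arbitrary functional `P` in place of the integral over
the unit interval: its boundary is the functional `f ↦ P (f')`, with values `m * P (m - 1)`. -/
theorem integralWord_stokes (P : ℕ → ℚ) (z : Comb) :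
    dLin (wordLin (integralWord P) z) + wordLin (integralWord P) (dLin z)
      = wordLin (evalWord fun m => m * P (m - 1)) z := by
  rw [dLin_eq]
  refine linearMap_family_ext_entries
    (F := fun P => wordLin (oddExt dRule) ∘ₗ wordLin (integralWord P)
      + wordLin (integralWord P) ∘ₗ wordLin (oddExt dRule))
    (G := fun P => wordLin (evalWord fun m => m * P (m - 1))) (fun P v n => ?_)
    (fun x z h P => ?_) P z
  · simp [oddExt_base, evalWord_base, integralWord_base]
  · simp only [LinearMap.comp_apply, LinearMap.add_apply] at h ⊢
    cases x with
    | leg1 l e =>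
      simp [oddExt_ent_mul, evalWord_leg1, integralWord_leg1, integralWord_leg2, dRule,
        Entry.sgn, Entry.deg, ← h, mul_add]
    | leg2 l e =>
      simp [oddExt_ent_mul, evalWord_leg2, integralWord_leg2, dRule, Entry.sgn,
        Entry.deg, ← h, mul_add]
    | hollow =>
      -- the derivative of `t ^ (m + 1)` is `t ^ m + m * t ^ m`
      have e : (fun m : ℕ => ((m + 1 : ℕ) : ℚ) * P (m + 1 - 1))
          = fun m => P m + m * P (m - 1 + 1) := by
        funext m
        cases m with
        | zero => simp
        | succ m => simp; ring
      simp only [oddExt_ent_mul, evalWord_hollow, integralWord_hollow, dRule, integralWord_filled,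
        map_add, map_smul, e, evalWord_add, ← h fun m => P (m + 1)]
      simp [Entry.sgn, Entry.deg]
      abel
    | filled =>
      have := evalWord_dLin P z
      rw [dLin_eq] at this
      simp [oddExt_ent_mul, evalWord_filled, integralWord_filled, dRule, Entry.sgn, Entry.deg,
        this]

theorem integralWord_iotaRaw (P : ℕ → ℚ) (z : Comb) :
    wordLin (integralWord P) (iotaRaw z) = -iotaRaw (wordLin (integralWord P) z) := by
  refine linearMap_family_ext_entries (F := fun P => wordLin (integralWord P) ∘ₗ iotaRaw)
    (G := fun P => -(iotaRaw ∘ₗ wordLin (integralWord P))) (fun P v n => ?_)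
    (fun x z h P => ?_) P z
  · simp [iotaRaw, oddExt_base, integralWord_base]
  · have he := evalWord_iotaRaw P z
    simp only [iotaRaw, LinearMap.comp_apply, LinearMap.neg_apply] at h he ⊢
    cases x <;>
      simp [oddExt_ent_mul, integralWord_leg1, integralWord_leg2, integralWord_hollow,
        integralWord_filled, iotaRule, h, he, Entry.sgn, Entry.deg, wordLin_vert_mul,
        wordLin_iotaEnd_mul, mul_assoc, add_comm]

/-- On diagrams without discs, evaluation of `θ` at `t = 1` is the identity. -/
theorem evalWord_one_thetaLin (D : PreDiagram) (hD : ∀ x ∈ D.word, x.isLeg = true) :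
    wordLin (evalWord fun _ => 1) (thetaLin (gen D)) = gen D := by
  obtain ⟨v, w, n⟩ := D
  rw [thetaLin_eq]
  induction w with
  | nil =>
    change wordLin _ (wordLin _ (base v n)) = base v n
    simp [multExt_base, evalWord_base]
  | cons x w ih =>
    have ih' := ih fun y hy => hD y (by simp [hy])
    have hx := hD x (by simp)
    rw [gen_cons, multExt_ent_mul]
    rcases x with ⟨_ | _, e⟩ | ⟨_ | _, e⟩ | _ | _ <;>
      simp_all [thetaRule, add_mul, sub_mul, mul_assoc, evalWord_leg1, evalWord_leg2,
        evalWord_hollow, evalWord_filled, Entry.isLeg]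

/-- On diagrams without discs, evaluation of `θ` at `t = 0` puts all legs on the commutative
line. -/
theorem evalWord_zero_thetaLin (D : PreDiagram) (hD : ∀ x ∈ D.word, x.isLeg = true) :
    wordLin (evalWord fun m => if m = 0 then 1 else 0) (thetaLin (gen D))
      = commLin (gen D) := by
  have h0 : ∀ z, wordLin (evalWord fun _ => 0) z = 0 := fun z => by
    simpa using evalWord_sub (fun _ => 0) (fun _ => 0) z
  obtain ⟨v, w, n⟩ := D
  rw [thetaLin_eq, commLin_eq]
  induction w with
  | nil =>
    change wordLin _ (wordLin _ (base v n)) = wordLin _ (base v n)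
    simp [multExt_base, evalWord_base]
  | cons x w ih =>
    have ih' := ih fun y hy => hD y (by simp [hy])
    have hx := hD x (by simp)
    rw [gen_cons, multExt_ent_mul, multExt_ent_mul]
    rcases x with ⟨_ | _, e⟩ | ⟨_ | _, e⟩ | _ | _ <;>
      simp_all [thetaRule, commRule, add_mul, sub_mul, mul_assoc, evalWord_leg1, evalWord_leg2,
        evalWord_hollow, evalWord_filled, Entry.isLeg]

/-- The homotopy formula for a single diagram without discs. -/
theorem intLin_thetaLin_homotopy (D : PreDiagram) (hD : ∀ x ∈ D.word, x.isLeg = true) :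
    dLin (intLin (thetaLin (gen D))) + intLin (thetaLin (dLin (gen D)))
      = gen D - commLin (gen D) := by
  -- the boundary of the integral over the unit interval is evaluation at `1` minus at `0`
  have e : (fun m : ℕ => (m : ℚ) * (1 / (((m - 1 : ℕ) : ℚ) + 1)))
      = fun m => 1 - if m = 0 then 1 else 0 := by
    funext m
    cases m with
    | zero => simp
    | succ m =>
      have : (m : ℚ) + 1 ≠ 0 := by positivity
      simp [this]
  rw [thetaLin_dLin, intLin_eq, integralWord_stokes, e, evalWord_sub, evalWord_one_thetaLin D hD,
    evalWord_zero_thetaLin D hD]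

theorem intLin_thetaLin_iotaLin (z : Comb) :
    intLin (thetaLin (iotaLin z)) + iotaLin (intLin (thetaLin z)) = 0 := by
  rw [iotaLin_eq, iotaLin_eq, ← intLin_relabelAlg, ← thetaLin_relabelAlg, thetaLin_iotaRaw,
    intLin_eq, integralWord_iotaRaw, neg_add_cancel]

/-! ### Attaching an edge at all legs -/

/-- Attach an edge that ends in the special vertex to a leg, the edge at the leg being broken into
`e` and `1`. -/
def attachRule : Entry → Comb
  | .leg1 l e => vert e 0 1 * iotaEnd 0 * ent (.leg1 l 1)
  | .leg2 l e => vert e 0 1 * iotaEnd 0 * ent (.leg2 l 1)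
  | .hollow => 0
  | .filled => 0

/-- The anticommutator of `ι` and `d`. By `attachLegs_ent_mul` it is the sum over all legs of the
diagrams with an edge to the special vertex attached at the leg. -/
def attachLegs (z : Comb) : Comb := iotaRaw (dLin z) + dLin (iotaRaw z)

theorem attachLegs_base (v : Multiset (ℕ × ℕ × ℕ)) (n : Multiset ℕ) :
    attachLegs (base v n) = 0 := by
  simp [attachLegs, iotaRaw, dLin_eq, oddExt_base]

theorem attachLegs_ent_mul (x : Entry) (z : Comb) :
    attachLegs (ent x * z) = attachRule x * z + ent x * attachLegs z := by
  simp only [attachLegs, iotaRaw, dLin_eq]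
  cases x <;>
    simp [oddExt_ent_mul, iotaRule, dRule, attachRule, wordLin_vert_mul, wordLin_iotaEnd_mul,
      mul_assoc, Entry.sgn, Entry.deg, mul_add] <;> abel

/-- Attach an edge that ends in the special vertex at the edge end `h` of `S`, where the edge ends of
`S` are thought of as having different names, and `f` tells which of them are joined. -/
def attach (S : PreDiagram) (f : ℕ → ℕ) (h : ℕ) : Comb :=
  gen (S.relabel (Function.update f h 1)) * (vert (f h) 0 1 * iotaEnd 0)

/-- Attach an edge that ends in the special vertex at any of the edge ends of `S`. -/
def attachSum (S : PreDiagram) (f : ℕ → ℕ) : Comb := (S.names.map (attach S f)).sum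

theorem entry_relabel_congr {f g : ℕ → ℕ} {x : Entry} (h : ∀ n ∈ x.names, f n = g n) :
    x.relabel f = x.relabel g := by
  cases x <;> simp_all [Entry.relabel, Entry.names]

theorem mem_sum_map_of_mem {α : Type*} {F : α → Multiset ℕ} {l : List α} {x : α} {n : ℕ}
    (hx : x ∈ l) (hn : n ∈ F x) : n ∈ (l.map F).sum := by
  induction l with
  | nil => simp at hx
  | cons y l ih =>
    rcases List.mem_cons.1 hx with rfl | hx
    · simp [hn]
    · simp [ih hx]

theorem relabel_congr {f g : ℕ → ℕ} {D : PreDiagram} (h : ∀ n ∈ D.names, f n = g n) :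
    D.relabel f = D.relabel g := by
  have hv : ∀ v ∈ D.verts, ∀ n ∈ ({v.1, v.2.1, v.2.2} : Multiset ℕ), f n = g n := by
    intro v hv n hn
    refine h n (Multiset.mem_add.2 (Or.inl (Multiset.mem_add.2 (Or.inl ?_))))
    obtain ⟨t, ht⟩ := Multiset.exists_cons_of_mem hv
    rw [ht, Multiset.map_cons, Multiset.sum_cons]
    exact Multiset.mem_add.2 (Or.inl hn)
  ext1
  · refine Multiset.map_congr rfl fun v hvm => ?_
    have := hv v hvm
    rw [this v.1 (by simp), this v.2.1 (by simp), this v.2.2 (by simp)]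
  · refine List.map_congr_left fun x hx => entry_relabel_congr fun n hn => ?_
    exact h n (Multiset.mem_add.2 (Or.inl (Multiset.mem_add.2
      (Or.inr (mem_sum_map_of_mem hx hn)))))
  · exact Multiset.map_congr rfl fun n hn => h n (Multiset.mem_add.2 (Or.inr hn))

theorem relabel_mul (f : ℕ → ℕ) (A B : PreDiagram) :
    (A * B).relabel f = A.relabel f * B.relabel f := (relabelHom f).map_mul A B

theorem vert_mul_iotaEnd_comm (a b c e : ℕ) (z : Comb) :
    z * (vert a b c * iotaEnd e) = vert a b c * iotaEnd e * z := by
  rw [vert_left_comm, iotaEnd_comm, mul_assoc]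

/-- Attaching an edge at any of the edge ends is a derivation. -/
theorem attachSum_mul {A B : PreDiagram} (f : ℕ → ℕ) (h : Disjoint A.names B.names) :
    attachSum (A * B) f
      = attachSum A f * gen (B.relabel f) + gen (A.relabel f) * attachSum B f := by
  rw [attachSum, names_mul, Multiset.map_add, Multiset.sum_add, attachSum, attachSum,
    Multiset.sum_map_mul_right.symm, Multiset.sum_map_mul_left.symm]
  congr 2
  · refine Multiset.map_congr rfl fun n hn => ?_
    have hB : B.relabel (Function.update f n 1) = B.relabel f := relabel_congr fun m hm =>
      Function.update_of_ne (by rintro rfl; exact Multiset.disjoint_left.1 h hn hm) _ _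
    rw [attach, attach, relabel_mul, hB, map_mul, mul_assoc, vert_mul_iotaEnd_comm, ← mul_assoc,
      vert_mul_iotaEnd_comm _ _ _ _ (gen _)]
  · refine Multiset.map_congr rfl fun n hn => ?_
    have hA : A.relabel (Function.update f n 1) = A.relabel f := relabel_congr fun m hm =>
      Function.update_of_ne (by rintro rfl; exact Multiset.disjoint_left.1 h hm hn) _ _
    rw [attach, attach, relabel_mul, hA, map_mul, mul_assoc]

/-- By IHX, the sum over the three edge ends at a trivalent vertex vanishes. -/
theorem attachSum_vert {a b c : ℕ} (f : ℕ → ℕ) (hab : a ≠ b) (hac : a ≠ c) (hbc : b ≠ c) :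
    attachSum ⟨{(a, b, c)}, [], 0⟩ f ∈ locSub := by
  have e : attachSum ⟨{(a, b, c)}, [], 0⟩ f
      = (vert 1 (f b) (f c) * vert (f a) 0 1 + vert (f a) 1 (f c) * vert (f b) 0 1
        + vert (f a) (f b) 1 * vert (f c) 0 1) * iotaEnd 0 := by
    simp [attachSum, attach, PreDiagram.names, PreDiagram.relabel, hab, hab.symm, hac, hac.symm,
      hbc, hbc.symm, vert, add_mul, mul_assoc, add_assoc]
  -- up to rotations of the vertices this is IHX for the edge `1`
  have h1 := loc_mul (loc_of_localRel (.ihx (f a) (f b) (f c) 0 1)) 1 (iotaEnd 0)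
  have rot : ∀ a b c, vert a b c - vert b c a ∈ locSub := fun a b c =>
    loc_of_localRel (.rotate a b c)
  have r1 := loc_mul (rot 1 (f c) 0) (vert (f a) (f b) 1) (iotaEnd 0)
  have r2 := loc_mul (rot 1 (f a) 0) (vert (f b) (f c) 1) (iotaEnd 0)
  have r3 := loc_mul (rot 1 (f b) 0) (vert (f c) (f a) 1) (iotaEnd 0)
  have q2 := loc_mul (rot 1 (f b) (f c)) 1 (vert (f a) 0 1 * iotaEnd 0)
  have q3 := loc_mul (rot (f c) (f a) 1) 1 (vert (f b) 0 1 * iotaEnd 0)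
  have := add_mem (add_mem (sub_mem (sub_mem (sub_mem h1 r1) r2) r3) q2) (neg_mem q3)
  rw [e]
  convert this using 1
  simp only [mul_add, add_mul, mul_sub, sub_mul, mul_assoc, one_mul]
  abel

/-- At an entry, only the edge end of a leg can have an edge attached. -/
theorem attachSum_entry (x : Entry) (f : ℕ → ℕ) :
    attachSum ⟨0, [x], 0⟩ f = attachRule (x.relabel f) := by
  cases x <;>
    simp [attachSum, attach, PreDiagram.names, Entry.names, PreDiagram.relabel, Entry.relabel,
      attachRule, ent, ← vert_mul_iotaEnd_comm]

/-- The edges attached at the trivalent vertices cancel, so that only those attached at legs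
remain. -/
theorem attachSum_sub_attachLegs (S : PreDiagram) (f : ℕ → ℕ) (hS : S.names.Nodup)
    (he : S.ends = 0) : attachSum S f - attachLegs (gen (S.relabel f)) ∈ locSub := by
  obtain ⟨v, w, n⟩ := S
  obtain rfl : n = 0 := he
  induction w with
  | nil =>
    have e : gen ((⟨v, [], 0⟩ : PreDiagram).relabel f)
        = base (v.map fun v => (f v.1, f v.2.1, f v.2.2)) 0 := rfl
    rw [e, attachLegs_base, sub_zero]
    clear e
    induction v using Multiset.induction_on with
    | empty => simp [attachSum, PreDiagram.names]
    | cons t v ih =>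
      obtain ⟨a, b, c⟩ := t
      have e : (⟨(a, b, c) ::ₘ v, [], 0⟩ : PreDiagram) = ⟨{(a, b, c)}, [], 0⟩ * ⟨v, [], 0⟩ := rfl
      rw [e, names_mul, Multiset.nodup_add] at hS
      rw [e, attachSum_mul f hS.2.2]
      have h3 := hS.1
      simp only [PreDiagram.names, Multiset.map_singleton, Multiset.sum_singleton, List.map_nil,
        List.sum_nil, add_zero, Multiset.insert_eq_cons, Multiset.nodup_cons, Multiset.mem_cons,
        Multiset.mem_singleton, not_or] at h3
      refine add_mem ?_ ?_
      · simpa using loc_mul (attachSum_vert f h3.1.1 h3.1.2 h3.2.1) 1 _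
      · simpa using loc_mul (ih hS.2.1) _ 1
  | cons x w ih =>
    have e : (⟨v, x :: w, 0⟩ : PreDiagram) = ⟨0, [x], 0⟩ * ⟨v, w, 0⟩ := by
      simp [PreDiagram.mul_def]
    rw [e, names_mul, Multiset.nodup_add] at hS
    have e2 : gen ((⟨0, [x], 0⟩ : PreDiagram).relabel f) = ent (x.relabel f) := rfl
    rw [e, attachSum_mul f hS.2.2, relabel_mul, map_mul, e2, attachLegs_ent_mul, attachSum_entry,
      add_sub_add_left_eq_sub, ← mul_sub]
    simpa using loc_mul (ih hS.2.1) (ent (x.relabel f)) 1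

/-- Attaching an edge from the two sides of an edge gives opposite signs. -/
theorem attach_add_attach_mem {S : PreDiagram} {f : ℕ → ℕ} {h h' : ℕ} (hne : h ≠ h')
    (hf : f h = f h') (hu : ∀ n ∈ S.names, f n = f h → n = h ∨ n = h')
    (hfr : ∀ n ∈ S.names, f n ≠ 0 ∧ f n ≠ 1) (hm : h ∈ S.names) :
    attach S f h + attach S f h' ∈ relSpan := by
  -- exchange the names of the two halves of the broken edge
  have hs : (Equiv.swap (f h) 1 : ℕ → ℕ).Injective := Equiv.injective _
  have h0 := hfr h hm
  have e : (S.relabel (Function.update f h 1)).relabel (Equiv.swap (f h) 1)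
      = S.relabel (Function.update f h' 1) := by
    rw [relabel_relabel]
    refine relabel_congr fun n hn => ?_
    rw [Function.comp_apply]
    by_cases h1 : n = h
    · subst h1
      rw [Function.update_self, Function.update_of_ne hne, Equiv.swap_apply_right]
    · by_cases h2 : n = h'
      · subst h2
        rw [Function.update_self, Function.update_of_ne h1, ← hf, Equiv.swap_apply_left]
      · rw [Function.update_of_ne h1, Function.update_of_ne h2]
        exact Equiv.swap_apply_of_ne_of_ne (fun e => (hu n hn e).elim h1 h2) (hfr n hn).2
  have r := sub_relabelAlg_mem _ hs (attach S f h)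
  have a := loc_mul (loc_of_localRel (.antisymm (f h) 0 1)) (gen (S.relabel
    (Function.update f h' 1))) (iotaEnd 0)
  have b := loc_mul (loc_of_localRel (.rotate 1 0 (f h))) (gen (S.relabel
    (Function.update f h' 1))) (iotaEnd 0)
  have c := loc_mul (loc_of_localRel (.rotate 0 (f h) 1)) (gen (S.relabel
    (Function.update f h' 1))) (iotaEnd 0)
  have c' := add_mem (add_mem r (relSpan_of_loc a)) (relSpan_of_loc b)
  rw [attach, map_mul, map_mul, relabelAlg_gen, relabelAlg_vert, relabelAlg_iotaEnd, e,
    Equiv.swap_apply_left, Equiv.swap_apply_right,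
    Equiv.swap_apply_of_ne_of_ne h0.1.symm zero_ne_one] at c'
  rw [attach, attach, ← hf]
  convert c' using 1
  simp only [mul_add, mul_sub, sub_mul, add_mul, mul_assoc]
  abel

/-- The edges attached from the two sides of all edges cancel. -/
theorem attachSum_mem_relSpan {S : PreDiagram} {f : ℕ → ℕ} (hS : S.names.Nodup)
    (hfr : ∀ n ∈ S.names, f n ≠ 0 ∧ f n ≠ 1)
    (h2 : ∀ e ∈ S.names.map f, (S.names.map f).count e = 2) : attachSum S f ∈ relSpan := by
  let s : Finset ℕ := ⟨S.names, hS⟩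
  change ∑ h ∈ s, attach S f h ∈ relSpan
  rw [← Finset.sum_fiberwise_of_maps_to (t := s.image f)
    (fun i hi => Finset.mem_image_of_mem f hi)]
  refine sum_mem fun e he => ?_
  have hc : (s.filter fun h => f h = e).card = 2 := by
    have := h2 e (by simpa [s] using he)
    rw [Multiset.count_map] at this
    simpa [s, Finset.card, eq_comm] using this
  obtain ⟨x, y, hxy, hs⟩ := Finset.card_eq_two.1 hc
  have mem : ∀ n, (n ∈ S.names ∧ f n = e) ↔ n = x ∨ n = y := fun n => by
    have := Finset.ext_iff.1 hs n
    simpa [s] using this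
  have hx := (mem x).2 (Or.inl rfl)
  have hy := (mem y).2 (Or.inr rfl)
  rw [hs, Finset.sum_pair hxy]
  exact attach_add_attach_mem hxy (hx.2.trans hy.2.symm)
    (fun n hn hnx => (mem n).1 ⟨hn, hnx.trans hx.2⟩) hfr hx.1

/-- Every diagram arises by naming the edge ends of a diagram in which these are all different. -/
theorem exists_nodup_relabel (D : PreDiagram) :
    ∃ (S : PreDiagram) (f : ℕ → ℕ), S.names.Nodup ∧ S.relabel f = D := by
  have mul : ∀ A B : PreDiagram,
      (∃ (S : PreDiagram) (f : ℕ → ℕ), S.names.Nodup ∧ S.relabel f = A) →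
      (∃ (S : PreDiagram) (f : ℕ → ℕ), S.names.Nodup ∧ S.relabel f = B) →
      ∃ (S : PreDiagram) (f : ℕ → ℕ), S.names.Nodup ∧ S.relabel f = A * B := by
    rintro _ _ ⟨S, f, hS, rfl⟩ ⟨T, g, hT, rfl⟩
    -- use the even names for the first factor and the odd ones for the second
    refine ⟨S.relabel (2 * ·) * T.relabel (2 * · + 1),
      fun n => if n % 2 = 0 then f (n / 2) else g (n / 2), ?_, ?_⟩
    · rw [names_mul, names_relabel, names_relabel, Multiset.nodup_add]
      refine ⟨hS.map fun a b h => ?_, hT.map fun a b h => ?_, ?_⟩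
      · simpa using h
      · simpa using h
      · rw [Multiset.disjoint_left]
        intro a ha hb
        obtain ⟨m, _, rfl⟩ := Multiset.mem_map.1 ha
        obtain ⟨n, _, hn⟩ := Multiset.mem_map.1 hb
        omega
    · rw [relabel_mul, relabel_relabel, relabel_relabel]
      congr 1
      · exact relabel_congr fun n _ => by simp
      · refine relabel_congr fun n _ => ?_
        have h1 : (2 * n + 1) % 2 ≠ 0 := by omega
        have h2 : (2 * n + 1) / 2 = n := by omega
        simp only [Function.comp_apply, if_neg h1, h2]
  obtain ⟨v, w, n⟩ := D
  induction w with
  | nil =>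
    induction v using Multiset.induction_on with
    | empty =>
      induction n using Multiset.induction_on with
      | empty => exact ⟨1, id, by simp [PreDiagram.names, PreDiagram.one_def], rfl⟩
      | cons e n ih =>
        have h := mul ⟨0, [], {e}⟩ _ ⟨⟨0, [], {0}⟩, fun _ => e, by simp [PreDiagram.names],
          by simp [PreDiagram.relabel]⟩ ih
        simpa [PreDiagram.mul_def] using h
    | cons t v ih =>
      obtain ⟨a, b, c⟩ := t
      have h := mul ⟨{(a, b, c)}, [], 0⟩ _ ⟨⟨{(0, 1, 2)}, [], 0⟩,
        fun n => if n = 0 then a else if n = 1 then b else c, by simp [PreDiagram.names],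
        by simp [PreDiagram.relabel]⟩ ih
      simpa [PreDiagram.mul_def] using h
  | cons x w ih =>
    have hx : ∃ (S : PreDiagram) (f : ℕ → ℕ), S.names.Nodup ∧ S.relabel f = ⟨0, [x], 0⟩ := by
      cases x with
      | leg1 l e => exact ⟨⟨0, [.leg1 l e], 0⟩, id, by simp [PreDiagram.names, Entry.names],
          by simp [PreDiagram.relabel, Entry.relabel]⟩
      | leg2 l e => exact ⟨⟨0, [.leg2 l e], 0⟩, id, by simp [PreDiagram.names, Entry.names],
          by simp [PreDiagram.relabel, Entry.relabel]⟩
      | hollow => exact ⟨⟨0, [.hollow], 0⟩, id, by simp [PreDiagram.names, Entry.names],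
          by simp [PreDiagram.relabel, Entry.relabel]⟩
      | filled => exact ⟨⟨0, [.filled], 0⟩, id, by simp [PreDiagram.names, Entry.names],
          by simp [PreDiagram.relabel, Entry.relabel]⟩
    have h := mul _ _ hx ih
    simpa [PreDiagram.mul_def] using h

/-- In a diagram without special vertices, the sum of all ways to attach an edge at a leg is zero. -/
theorem attachLegs_mem_relSpan {D : PreDiagram} (he : D.ends = 0)
    (hfr : ∀ e ∈ D.names, e ≠ 0 ∧ e ≠ 1) (h2 : ∀ e ∈ D.names, D.names.count e = 2) :
    attachLegs (gen D) ∈ relSpan := by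
  obtain ⟨S, f, hS, rfl⟩ := exists_nodup_relabel D
  rw [names_relabel] at hfr h2
  have h := sub_mem
    (attachSum_mem_relSpan hS (fun n hn => hfr _ (Multiset.mem_map_of_mem f hn)) h2)
    (relSpan_of_loc (attachSum_sub_attachLegs S f hS (Multiset.map_eq_zero.1 he)))
  rwa [sub_sub_cancel] at h

theorem iotaLin_dLin_add_mem {κ : Kind} {i : ℤ} {D : PreDiagram} (hD : IsDiagram κ 0 i D) :
    iotaLin (dLin (gen D)) + dLin (iotaLin (gen D)) ∈ relSpan := by
  rw [iotaLin_eq, iotaLin_eq, ← dLin_relabelAlg, relabelAlg_gen]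
  have hD' := (isDiagram_relabel (· + 2) (fun a b h => Nat.add_right_cancel h) D).2 hD
  refine attachLegs_mem_relSpan (Multiset.card_eq_zero.1 hD'.card_ends) ?_ hD'.count_names
  intro e he
  rw [names_relabel] at he
  obtain ⟨a, _, rfl⟩ := Multiset.mem_map.1 he
  omega

/-! ### Passage to the quotients -/

/-- The class of a combination of diagrams. -/
def cls (κ : Kind) (k : ℕ) (i : ℤ) (x : Comb) (hx : x ∈ diagrams κ k i) : Space κ k i :=
  Submodule.Quotient.mk ⟨x, hx⟩

theorem cls_eq {κ : Kind} {k : ℕ} {i : ℤ} {x y : Comb} {hx : x ∈ diagrams κ k i}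
    {hy : y ∈ diagrams κ k i} (h : x - y ∈ relSpan) : cls κ k i x hx = cls κ k i y hy :=
  (Submodule.Quotient.eq _).2 (mem_relations _ (sub_mem hx hy) h)

theorem space_hom_ext {κ : Kind} {k : ℕ} {i : ℤ} {N : Type*} [AddCommGroup N] [Module ℚ N]
    {F G : Space κ k i →ₗ[ℚ] N}
    (h : ∀ D (hD : IsDiagram κ k i D),
      F (cls κ k i (gen D) (gen_mem hD)) = G (cls κ k i (gen D) (gen_mem hD))) : F = G := by
  refine Submodule.linearMap_qext _ (LinearMap.ext fun x => ?_)
  obtain ⟨x, hx⟩ := x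
  change F (cls κ k i x hx) = G (cls κ k i x hx)
  induction hx using Submodule.span_induction with
  | mem x hx => obtain ⟨D, hD, rfl⟩ := hx; exact h D hD
  | zero => exact (map_zero F).trans (map_zero G).symm
  | add x y hx hy ihx ihy =>
    exact (map_add F (cls κ k i x hx) (cls κ k i y hy)).trans
      ((congrArg₂ _ ihx ihy).trans (map_add G (cls κ k i x hx) (cls κ k i y hy)).symm)
  | smul c x hx ihx =>
    exact (map_smul F c (cls κ k i x hx)).trans
      ((congrArg _ ihx).trans (map_smul G c (cls κ k i x hx)).symm)

theorem isIotaComplex_system (κ : Kind) : (system κ).IsIotaComplex where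
  d_comp_d i j k hij hjk := space_hom_ext fun D hD =>
    cls_eq (x := dLin (dLin (gen D))) (y := 0) (hy := zero_mem _)
      (by rw [dLin_dLin, sub_zero]; exact zero_mem _)
  dIota_comp_dIota i j k hij hjk := space_hom_ext fun D hD =>
    cls_eq (x := dLin (dLin (gen D))) (y := 0) (hy := zero_mem _)
      (by rw [dLin_dLin, sub_zero]; exact zero_mem _)
  iota_comp_d i j k hij hki := space_hom_ext fun D hD =>
    cls_eq (x := iotaLin (dLin (gen D))) (y := -dLin (iotaLin (gen D)))
      (by rw [sub_neg_eq_add]; exact iotaLin_dLin_add_mem hD)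

theorem isIotaMap_iN : iN.IsIotaMap where
  comm_d _ _ _ := space_hom_ext fun _ _ => rfl
  comm_dIota _ _ _ := space_hom_ext fun _ _ => rfl
  comm_iota _ _ _ := space_hom_ext fun _ _ => rfl

theorem isIotaMap_iC : iC.IsIotaMap where
  comm_d i j h := space_hom_ext fun D hD =>
    cls_eq (x := commLin (dLin (gen D))) (y := dLin (commLin (gen D)))
      (by rw [commLin_dLin, sub_self]; exact zero_mem _)
  comm_dIota i j h := space_hom_ext fun D hD =>
    cls_eq (x := commLin (dLin (gen D))) (y := dLin (commLin (gen D)))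
      (by rw [commLin_dLin, sub_self]; exact zero_mem _)
  comm_iota i j h := space_hom_ext fun D hD =>
    cls_eq (x := commLin (iotaLin (gen D))) (y := iotaLin (commLin (gen D)))
      (by
        rw [iotaLin_eq, iotaLin_eq, commLin_iotaRaw, commLin_relabelAlg, sub_self]
        exact zero_mem _)

theorem isLeg_of_isDiagram {k : ℕ} {i : ℤ} {D : PreDiagram} (hD : IsDiagram .W k i D) :
    ∀ x ∈ D.word, x.isLeg = true := fun x hx => allows_W_T x (hD.allows x hx)

theorem isIotaChainHomotopy_sT : sT.IsIotaChainHomotopy iN iC where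
  homotopy i j k hij hik := space_hom_ext fun D hD =>
    cls_eq (x := dLin (intLin (thetaLin (gen D))) + intLin (thetaLin (dLin (gen D))))
      (y := gen D - commLin (gen D))
      (by rw [intLin_thetaLin_homotopy D (isLeg_of_isDiagram hD), sub_self]; exact zero_mem _)
  homotopyIota i j k hij hik := space_hom_ext fun D hD =>
    cls_eq (x := dLin (intLin (thetaLin (gen D))) + intLin (thetaLin (dLin (gen D))))
      (y := gen D - commLin (gen D))
      (by rw [intLin_thetaLin_homotopy D (isLeg_of_isDiagram hD), sub_self]; exact zero_mem _)
  comm_iota i j k hij hjk := space_hom_ext fun D hD =>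
    cls_eq (x := intLin (thetaLin (iotaLin (gen D))) + iotaLin (intLin (thetaLin (gen D))))
      (y := 0) (hy := zero_mem _)
      (by rw [intLin_thetaLin_iotaLin, sub_zero]; exact zero_mem _)

end WeilDiag
end

/-- `W̃` and `T` are `ι`-complexes, `i_n` and `i_c` are maps of `ι`-complexes, and `∫ ∘ θ` is an
`ι`-chain homotopy between them. -/
theorem mainTheorem3 :
    (WeilDiag.system .W).IsIotaComplex ∧ (WeilDiag.system .T).IsIotaComplex ∧
    WeilDiag.iN.IsIotaMap ∧ WeilDiag.iC.IsIotaMap ∧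
    WeilDiag.sT.IsIotaChainHomotopy WeilDiag.iN WeilDiag.iC :=
  ⟨WeilDiag.isIotaComplex_system _, WeilDiag.isIotaComplex_system _, WeilDiag.isIotaMap_iN,
    WeilDiag.isIotaMap_iC, WeilDiag.isIotaChainHomotopy_sT⟩
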